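/- **Lemma 3.2 (Equivariant Moving Lemma).** Let $Y$ be an irreducible normal affine complex algebraic variety with a regular action $\mathbb{C}^*\times Y\to Y$, let $Y^{\mathbb{C}^*}$ be its fixed point set, and let $p\colon Y\to Y/\!/\mathbb{C}^*$ be the algebraic quotient, i.e. the map defined by the inclusion $\mathbb{C}[Y]^{\mathbb{C}^*}\subset\mathbb{C}[Y]$. Let $V\subset Y\setminus Y^{\mathbb{C}^*}$ be a non-empty Zariski open $\mathbb{C}^*$-stable set such that for every $z\in p(V)$ - the fibre $V\cap p^{-1}(z)$ of $p|_V$ is regular, i.e. $z$ is a regular point of $Y/\!/\mathbb{C}^*$, every point of $V\cap p^{-1}(z)$ is a regular point of $Y$, and the differential of $p$ is surjective at every point of $V\cap p^{-1}(z)$; - the full fibre $p^{-1}(z)\subset Y$ is irreducible. Let $D\subset Y\setminus V$ be a closed $\mathbb{C}^*$-stable subset of pure codimension one in $Y$, let $A\subset V$ be a $\mathbb{C}^*$-stable subset that is closed in $V$, and let $y\in Y\setminus D$. Then there is a homogeneous function $f\in\mathbb{C}[Y]$ (that is, for some $k\in\mathbb{Z}$ one has $f(t\cdot x)=t^kf(x)$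 for all $t\in\mathbb{C}^*$, $x\in Y$) such that 1. $f|_D=0$ and $f(y)\neq 0$; 2. the zero set $\{x\in V : f(x)=0\}$ contains no irreducible component of $A$. -/

import Mathlib

namespace CStarVariety

/-- The (closed) points of the affine complex variety with coordinate ring `R`, i.e. the
`ℂ`-algebra homomorphisms `R → ℂ`. The value of a regular function `f : R` at `y` is `y f`. -/
def Points (R : Type*) [CommRing R] [Algebra ℂ R] : Type _ := R →ₐ[ℂ] ℂ

section Basic

variable {R : Type*} [CommRing R] [Algebra ℂ R]

instance : FunLike (Points R) R ℂ := inferInstanceAs (FunLike (R →ₐ[ℂ] ℂ) R ℂ)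

instance : AlgHomClass (Points R) ℂ R ℂ := inferInstanceAs (AlgHomClass (R →ₐ[ℂ] ℂ) ℂ R ℂ)

/-- The Zariski topology: the closed sets are the common zero sets of sets of regular functions
(it is induced from the prime spectrum by sending a point to its maximal ideal). -/
instance : TopologicalSpace (Points R) :=
  TopologicalSpace.induced
    (fun y : Points R => (⟨RingHom.ker y, RingHom.ker_isPrime y⟩ : PrimeSpectrum R))
    inferInstance

/-- The closed sets of the Zariski topology are exactly the common zero sets. -/
theorem isClosed_iff_zeroLocus (Z : Set (Points R)) :
    IsClosed Z ↔ ∃ S : Set R, Z = {y | ∀ f ∈ S, y f = 0} := by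
  rw [isClosed_induced_iff]
  constructor
  · rintro ⟨C, hC, rfl⟩
    obtain ⟨S, rfl⟩ := (PrimeSpectrum.isClosed_iff_zeroLocus C).1 hC
    exact ⟨S, rfl⟩
  · rintro ⟨S, rfl⟩
    exact ⟨PrimeSpectrum.zeroLocus S, PrimeSpectrum.isClosed_zeroLocus S, rfl⟩

/-- The map on points defined by a homomorphism of coordinate rings. -/
def Points.comap {S : Type*} [CommRing S] [Algebra ℂ S] (φ : S →ₐ[ℂ] R) (y : Points R) :
    Points S :=
  AlgHom.comp (show R →ₐ[ℂ] ℂ from y) φ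

theorem Points.comap_apply {S : Type*} [CommRing S] [Algebra ℂ S] (φ : S →ₐ[ℂ] R)
    (y : Points R) (f : S) : y.comap φ f = y (φ f) := rfl

/-- `y` is a regular (i.e. non-singular) point: the local ring at `y` is a regular local ring. -/
def IsRegularPoint (y : Points R) : Prop :=
  haveI : (RingHom.ker y).IsPrime := RingHom.ker_isPrime y
  IsRegularLocalRing (Localization.AtPrime (RingHom.ker y))

/-- The Zariski tangent space at `y`: the point derivations `δ : R → ℂ` at `y`. -/
def tangentSpace (y : Points R) : Submodule ℂ (R →ₗ[ℂ] ℂ) where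
  carrier := {δ | ∀ f g : R, δ (f * g) = y f * δ g + y g * δ f}
  add_mem' := by
    intro a b ha hb f g
    simp only [LinearMap.add_apply, ha f g, hb f g]
    ring
  zero_mem' := by
    intro f g
    simp
  smul_mem' := by
    intro c a ha f g
    simp only [LinearMap.smul_apply, ha f g, smul_eq_mul]
    ring

/-- The differential at `y` of the map on points defined by `φ`. -/
def differential {S : Type*} [CommRing S] [Algebra ℂ S] (φ : S →ₐ[ℂ] R) (y : Points R) :
    tangentSpace y →ₗ[ℂ] tangentSpace (y.comap φ) where
  toFun δ := ⟨δ.1.comp φ.toLinearMap, fun f g => by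
    simpa [Points.comap_apply] using δ.2 (φ f) (φ g)⟩
  map_add' _ _ := rfl
  map_smul' _ _ := rfl

end Basic

section Topology

variable {X : Type*} [TopologicalSpace X]

/-- The irreducible components of a subset `A` (with the subspace topology), as subsets of the
ambient space. -/
def componentsOf (A : Set X) : Set (Set X) :=
  (fun Z : Set A => Subtype.val '' Z) '' irreducibleComponents A

/-- `D` has pure codimension one: every irreducible component of `D` has codimension one in the
ambient space. (The codimension of an irreducible closed set `Z` is the supremum of the lengths
of chains of irreducible closed sets starting at `Z`. Meant for closed `D`; then all irreducible
components of `D` are closed in `X`.) -/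
def IsPureCodimOne (D : Set X) : Prop :=
  ∀ Z : TopologicalSpace.IrreducibleCloseds X, (Z : Set X) ∈ componentsOf D → Order.coheight Z = 1

/-- `A` is a subset of `V` that is closed in the subspace topology of `V`. -/
def IsClosedIn (A V : Set X) : Prop :=
  A ⊆ V ∧ IsClosed (Subtype.val ⁻¹' A : Set V)

end Topology

section Action

variable (R : Type*) [CommRing R] [Algebra ℂ R] [MulAction ℂˣ (Points R)]

/-- The action map `ℂ* × Y → Y` is a morphism of varieties: for every regular function `f` on `Y`,
the function `(t, y) ↦ f (t • y)` is a regular function on `ℂ* × Y`, that is, it is given by an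
element of the coordinate ring `R[T, T⁻¹]` of `ℂ* × Y`. -/
def IsRegularAction : Prop :=
  ∀ f : R, ∃ q : LaurentPolynomial R, ∀ (t : ℂˣ) (y : Points R),
    (t • y) f = LaurentPolynomial.eval₂ (y : R →+* ℂ) t q

/-- The algebra of invariant regular functions. -/
def invariants : Subalgebra ℂ R where
  carrier := {f | ∀ (t : ℂˣ) (y : Points R), (t • y) f = y f}
  mul_mem' := by
    intro a b ha hb t y
    simp only [map_mul, ha t y, hb t y]
  add_mem' := by
    intro a b ha hb t y
    simp only [map_add, ha t y, hb t y]
  algebraMap_mem' := by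
    intro c t y
    simp only [AlgHomClass.commutes]

variable {R}

/-- The algebraic quotient `p : Y → Y // ℂ*`, defined by the inclusion of the invariants. -/
def quotientMap (y : Points R) : Points (invariants R) := y.comap (invariants R).val

/-- The differential of the quotient map at a point. -/
def quotientDifferential (y : Points R) :
    tangentSpace y →ₗ[ℂ] tangentSpace (quotientMap y) :=
  differential (invariants R).val y

/-- A regular function `f` is homogeneous: it transforms under some character `t ↦ t ^ k`
of `ℂ*`. -/
def IsHomogeneous (f : R) : Prop :=
  ∃ k : ℤ, ∀ (t : ℂˣ) (y : Points R), (t • y) f = (t : ℂ) ^ k * y f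

/-- A set of points that is stable under the action of `ℂ*`. -/
def IsStable (A : Set (Points R)) : Prop :=
  ∀ (t : ℂˣ), ∀ y ∈ A, t • y ∈ A

/-- The fibre of `p|_V` over `z` is regular: `z` is a regular point of `Y // ℂ*`, all points of
the fibre are regular points of `Y`, and the differential of `p` is surjective at all of them. -/
def IsRegularFibre (V : Set (Points R)) (z : Points (invariants R)) : Prop :=
  IsRegularPoint z ∧
    ∀ y ∈ V, quotientMap y = z →
      IsRegularPoint y ∧ Function.Surjective (quotientDifferential y)

/-- A non-empty open `ℂ*`-stable set `V` without fixed points such that `p|_V` has only regular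
fibres and the full fibre `p⁻¹(z)` is irreducible for every `z ∈ p(V)`. -/
structure IsRegularOpenSet (V : Set (Points R)) : Prop where
  nonempty : V.Nonempty
  isOpen : IsOpen V
  stable : IsStable V
  subset_compl_fixedPoints : V ⊆ (MulAction.fixedPoints ℂˣ (Points R))ᶜ
  regularFibre : ∀ z ∈ quotientMap '' V, IsRegularFibre V z
  irreducible_fibre : ∀ z ∈ quotientMap '' V, IsIrreducible (quotientMap ⁻¹' {z})

end Action

end CStarVariety

/-!
Let `m` be the maximal ideal of the image of a point `v` of `V` in the quotient. The heart of the
proof is `IsRegularOpenSet.le_ker_of_height_le_one`: a stable prime divisor `E` that does not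
dominate the quotient and whose image contains that of `v` must contain `v`. Regularity of the
fibre says that a basis of the cotangent space of the quotient stays independent in that of `Y`;
hence the fibre has codimension at least `m.height`. On the other hand the image of `E` has positive
codimension, so inside `E` the fibre is cut out by at most `m.height - 1` equations, and its
intersection with `E` has a component of codimension at most `m.height` in `Y`. Since the fibre is
irreducible, `E` contains it. This uses that domains of finite type over `ℂ` are catenary
(`Ideal.height_le_height_add_height_map`), which is derived here from Noether normalization, going
down and Krull's height theorem.

The action is encoded as a `ℤ`-grading of the coordinate ring by weights. The ideal of `D` is
homogeneous, so some weight vector in it does not vanish at `y`, and the same holds for each of the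
finitely many points obtained by choosing one in every component of `A`. What remains is to
arrange that all these functions have the same weight; then a general linear combination of them
is as desired, because a vector space over an infinite field is not a finite union of proper
subspaces.

* If `y` is not fixed, then its function may be taken of weight `k ≠ 0`. A point `v` of `V` is
  not fixed either, so some weight vector of non-zero weight does not vanish at `v`. If its weight
  has the wrong sign, then weights of both signs occur, no component of its zero set dominates the
  quotient, and the result on divisors shows that it is invertible near the fibre through `v`; its
  inverse then has the right sign (`exists_mem_weightSpace_neg`). So a positive multiple of `k` is
  available at `v`, and taking powers gives a common weight.
* If `y` is fixed, then its function has weight `0`, so no component of `D` dominates the quotient.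
  As `D` has pure codimension one, the result on divisors shows that the images of `D` and `V` are
  disjoint, and weight `0` is available at every point of `V`.
-/

/-! ### Heights of primes in domains of finite type -/

/-- All maximal ideals of a polynomial ring over `ℂ` have the same height, since translations
permute them transitively. -/
theorem MvPolynomial.height_eq_of_isMaximal {s : ℕ} (M : Ideal (MvPolynomial (Fin s) ℂ))
    [hM : M.IsMaximal] : M.height = s := by
  obtain ⟨M₀, hM₀, h₀⟩ : ∃ M₀ : Ideal (MvPolynomial (Fin s) ℂ), M₀.IsMaximal ∧ M₀.height = s := by
    have hdim : ringKrullDim (MvPolynomial (Fin s) ℂ) = s := by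
      rw [MvPolynomial.ringKrullDim_of_isNoetherianRing, ringKrullDim_eq_zero_of_field]
      simp
    have : FiniteRingKrullDim (MvPolynomial (Fin s) ℂ) := by
      rw [finiteRingKrullDim_iff_ne_bot_and_top, hdim]
      exact ⟨WithBot.coe_ne_bot, WithBot.coe_injective.ne (ENat.natCast_ne_top s)⟩
    obtain ⟨M₀, hM₀, h⟩ := Ideal.exists_isMaximal_height (R := MvPolynomial (Fin s) ℂ)
    refine ⟨M₀, hM₀, ?_⟩
    rw [hdim] at h
    exact_mod_cast h
  obtain ⟨x, rfl⟩ := MvPolynomial.isMaximal_iff_eq_vanishingIdeal_singleton.1 hM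
  obtain ⟨x₀, rfl⟩ := MvPolynomial.isMaximal_iff_eq_vanishingIdeal_singleton.1 hM₀
  -- the translation moving `x₀` to `x`
  let τ (c : Fin s → ℂ) : MvPolynomial (Fin s) ℂ →ₐ[ℂ] MvPolynomial (Fin s) ℂ :=
    MvPolynomial.aeval fun i => MvPolynomial.X i + MvPolynomial.C (c i)
  have hτ (c c' : Fin s → ℂ) (h : c + c' = 0) : (τ c).comp (τ c') = AlgHom.id ℂ _ := by
    ext1 i
    have : c i + c' i = 0 := congrFun h i
    simp only [τ, AlgHom.comp_apply, MvPolynomial.aeval_X, map_add, MvPolynomial.algHom_C,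
      MvPolynomial.algebraMap_eq, AlgHom.id_apply]
    rw [add_assoc, ← map_add, this, map_zero, add_zero]
  let e : MvPolynomial (Fin s) ℂ ≃ₐ[ℂ] MvPolynomial (Fin s) ℂ :=
    AlgEquiv.ofAlgHom (τ (x - x₀)) (τ (x₀ - x)) (hτ _ _ (by simp)) (hτ _ _ (by simp))
  have key : MvPolynomial.vanishingIdeal ℂ {x} =
      (MvPolynomial.vanishingIdeal ℂ {x₀}).comap (e : _ ≃+* _) := by
    ext p
    simp only [Ideal.mem_comap, MvPolynomial.mem_vanishingIdeal_singleton_iff]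
    have : (MvPolynomial.aeval x₀).comp (e : _ →ₐ[ℂ] _) = MvPolynomial.aeval x := by
      ext i
      simp [e, τ]
    have := DFunLike.congr_fun this p
    simp only [AlgHom.comp_apply] at this
    rw [← this]; rfl
  rw [key, RingEquiv.height_comap, h₀]

/-- A domain of finite type over `ℂ` is equicodimensional, by Noether normalization and going
down. -/
theorem Ideal.exists_height_eq_of_isMaximal (R : Type*) [CommRing R] [IsDomain R] [Algebra ℂ R]
    [Algebra.FiniteType ℂ R] : ∃ n : ℕ, ∀ M : Ideal R, M.IsMaximal → M.height = n := by
  obtain ⟨s, g, hg, hint⟩ := exists_integral_inj_algHom_of_fg ℂ R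
  refine ⟨s, fun M hM => ?_⟩
  algebraize [g.toRingHom]
  have : FaithfulSMul (MvPolynomial (Fin s) ℂ) R := (faithfulSMul_iff_algebraMap_injective _ _).2 hg
  have : IsNoetherianRing R := Algebra.FiniteType.isNoetherianRing ℂ R
  have hmax : (M.under (MvPolynomial (Fin s) ℂ)).IsMaximal := inferInstance
  set m := M.under (MvPolynomial (Fin s) ℂ) with hm
  -- primes of the fibre over the maximal ideal `m` are maximal, as `R` is integral
  have hzero : (M.map (Ideal.Quotient.mk (m.map (algebraMap _ R)))).height = 0 := by
    have hle : m.map (algebraMap _ R) ≤ M := Ideal.map_comap_le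
    have : (M.map (Ideal.Quotient.mk (m.map (algebraMap _ R)))).IsPrime :=
      Ideal.isPrime_map_quotientMk_of_isPrime hle
    rw [Ideal.height_eq_zero_iff]
    refine ⟨⟨this, bot_le⟩, fun p hp hpM => ?_⟩
    have := hp.1
    have hpM' : p.comap (Ideal.Quotient.mk (m.map (algebraMap _ R))) ≤ M := by
      refine (Ideal.comap_mono hpM).trans_eq ?_
      rw [Ideal.comap_map_of_surjective _ Ideal.Quotient.mk_surjective, ← RingHom.ker_eq_comap_bot,
        Ideal.mk_ker, sup_eq_left.2 hle]
    have hlie : (p.comap (Ideal.Quotient.mk (m.map (algebraMap _ R)))).under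
        (MvPolynomial (Fin s) ℂ) = m := by
      refine le_antisymm (Ideal.comap_mono hpM') ?_
      rw [Ideal.under_def, ← Ideal.map_le_iff_le_comap, ← Ideal.map_le_iff_le_comap]
      simp
    have hpmax : (p.comap (Ideal.Quotient.mk (m.map (algebraMap _ R)))).IsMaximal :=
      Ideal.isMaximal_of_isIntegral_of_isMaximal_comap _ (hlie ▸ hmax)
    rw [← hpmax.eq_of_le hM.ne_top hpM', Ideal.map_comap_of_surjective _
      Ideal.Quotient.mk_surjective]
  rw [Ideal.height_eq_height_add_of_liesOver_of_hasGoingDown m M,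
    MvPolynomial.height_eq_of_isMaximal, hzero, add_zero]

section
variable {R B : Type*} [CommRing R] [CommRing B]

theorem Ideal.height_ker_add_le_height_comap [IsNoetherianRing R] (f : R →+* B)
    (hf : Function.Surjective f) [IsDomain B] (M : Ideal B) [M.IsPrime] :
    (RingHom.ker f).height + M.height ≤ (M.comap f).height := by
  have : IsNoetherianRing B := isNoetherianRing_of_surjective _ _ f hf
  have : (RingHom.ker f).IsPrime := RingHom.ker_isPrime f
  obtain ⟨l, hl, hl'⟩ := (RingHom.ker f).exists_ltSeries_length_eq_height
  obtain ⟨q, hq, hq'⟩ := M.exists_ltSeries_length_eq_height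
  let q' := q.map (PrimeSpectrum.comap f) (RingHom.strictMono_comap_of_surjective hf)
  have hlast : (q'.last).asIdeal = M.comap f := by
    simp [q', LTSeries.last_map, hq]
  have hle : l.last ≤ q'.head := by
    rw [hl, ← PrimeSpectrum.asIdeal_le_asIdeal]
    exact fun x hx => by simp [q', (RingHom.mem_ker).1 hx]
  rw [← hl', ← hq', ← hlast, PrimeSpectrum.height_eq_orderHeight]
  -- the chains are concatenated, either at a common member or by one further step
  rcases hle.eq_or_lt with h | h
  · have := Order.length_le_height_last (p := l.smash q' h)
    simpa [q'] using this
  · have := Order.length_le_height_last (p := l.append q' h)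
    refine le_trans ?_ (le_trans this ?_)
    · simp [q']
    · simp

/-- The inequality between heights that makes domains of finite type over `ℂ` catenary, here for a
maximal ideal of the quotient. By equicodimensionality it suffices to compare the heights at one
maximal ideal, which can be chosen off the other components of a set of equations for `ker f`. -/
theorem Ideal.height_comap_le_height_ker_add [IsDomain R] [Algebra ℂ R]
    [Algebra.FiniteType ℂ R] (f : R →+* B)
    (hf : Function.Surjective f) [IsDomain B] (M : Ideal B) [M.IsMaximal] :
    (M.comap f).height ≤ (RingHom.ker f).height + M.height := by
  have hQ : (RingHom.ker f).IsPrime := RingHom.ker_isPrime f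
  have : IsNoetherianRing R := Algebra.FiniteType.isNoetherianRing ℂ R
  have : IsJacobsonRing R := isJacobsonRing_of_finiteType (A := ℂ)
  obtain ⟨n, hn⟩ := Ideal.exists_height_eq_of_isMaximal R
  let : Algebra ℂ B := (f.comp (algebraMap ℂ R)).toAlgebra
  have : Algebra.FiniteType ℂ B := Algebra.FiniteType.of_surjective (A := R) ⟨f, fun _ => rfl⟩ hf
  obtain ⟨m, hm⟩ := Ideal.exists_height_eq_of_isMaximal B
  obtain ⟨s, hs, hcard⟩ := (RingHom.ker f).exists_finset_card_eq_height_of_isNoetherianRing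
  set I := Ideal.span (s : Set R)
  have hIQ : I ≤ RingHom.ker f := hs.1.2
  -- a maximal ideal containing `ker f`, but no other minimal prime of `I`
  obtain ⟨N, hN, hQN, hNI⟩ : ∃ N : Ideal R, N.IsMaximal ∧ RingHom.ker f ≤ N ∧
      ∀ p : Ideal R, p.IsPrime → I ≤ p → p ≤ N → RingHom.ker f ≤ p := by
    have hfin : (I.minimalPrimes \ {RingHom.ker f}).Finite :=
      (Ideal.finite_minimalPrimes_of_isNoetherianRing R I).subset Set.sdiff_subset
    have hnot : ¬ (hfin.toFinset.inf id ≤ RingHom.ker f) := by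
      rw [hQ.inf_le']
      rintro ⟨p, hp, hpQ⟩
      simp only [Set.Finite.mem_toFinset, Set.mem_sdiff, Set.mem_singleton_iff] at hp
      exact hp.2 (le_antisymm hpQ (hs.2 hp.1.1 hpQ))
    obtain ⟨c, hc, hcQ⟩ := SetLike.not_le_iff_exists.1 hnot
    have hjac : (RingHom.ker f).jacobson = RingHom.ker f :=
      IsJacobsonRing.out' _ hQ.isRadical
    rw [← hjac, Ideal.jacobson, Submodule.mem_sInf] at hcQ
    push Not at hcQ
    obtain ⟨N, ⟨hQN, hN⟩, hcN⟩ := hcQ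
    refine ⟨N, hN, hQN, fun p hp hIp hpN => ?_⟩
    obtain ⟨p', hp', hp'p⟩ := Ideal.exists_minimalPrimes_le hIp
    by_cases h : p' = RingHom.ker f
    · exact h ▸ hp'p
    · refine absurd (hpN (hp'p ?_)) hcN
      have hmem : p' ∈ hfin.toFinset := by simpa using ⟨hp', h⟩
      exact (Finset.inf_le (f := id) hmem : _ ≤ id p') hc
  have hIN := hIQ.trans hQN
  have hNp : (N.map (Ideal.Quotient.mk I)).IsPrime := Ideal.isPrime_map_quotientMk_of_isPrime hIN
  have hNmap : (N.map f).IsMaximal := by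
    refine (Ideal.map_eq_top_or_isMaximal_of_surjective f hf hN).resolve_left fun h => hN.ne_top ?_
    rw [← sup_eq_left.2 hQN, RingHom.ker_eq_comap_bot, ← Ideal.comap_map_of_surjective f hf, h,
      Ideal.comap_top]
  -- the primes of `R` between `I` and `N` all contain `ker f`, so they come from primes of `B`
  have hle : (N.map (Ideal.Quotient.mk I)).height ≤ (N.map f).height := by
    obtain ⟨l, hl, hlen⟩ := (N.map (Ideal.Quotient.mk I)).exists_ltSeries_length_eq_height
    let P (i : Fin (l.length + 1)) : Ideal R := (l i).asIdeal.comap (Ideal.Quotient.mk I)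
    have hPmono : StrictMono P := fun i j hij =>
      PrimeSpectrum.asIdeal_lt_asIdeal _ _ |>.2 <|
        RingHom.strictMono_comap_of_surjective Ideal.Quotient.mk_surjective (l.strictMono hij)
    have hPlast : P (Fin.last _) = N := by
      have : (l (Fin.last _)).asIdeal = N.map (Ideal.Quotient.mk I) :=
        congrArg PrimeSpectrum.asIdeal hl
      simp only [P]
      rw [this, Ideal.comap_map_of_surjective _ Ideal.Quotient.mk_surjective,
        ← RingHom.ker_eq_comap_bot, Ideal.mk_ker, sup_eq_left.2 hIN]
    have hPQ (i) : RingHom.ker f ≤ P i := by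
      refine hNI (P i) (Ideal.comap_isPrime _ _) ?_ (hPlast ▸ hPmono.monotone (Fin.le_last i))
      intro x hx
      simp [P, Ideal.Quotient.eq_zero_iff_mem.2 hx]
    have hcm (i) : ((P i).map f).comap f = P i := by
      rw [Ideal.comap_map_of_surjective f hf, ← RingHom.ker_eq_comap_bot, sup_eq_left.2 (hPQ i)]
    let l' : LTSeries (PrimeSpectrum B) :=
      { length := l.length
        toFun := fun i => ⟨(P i).map f,
          haveI : (P i).IsPrime := Ideal.comap_isPrime _ _
          Ideal.map_isPrime_of_surjective hf (hPQ i)⟩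
        step := fun i => by
          have := hPmono (Fin.castSucc_lt_succ (i := i))
          rw [← hcm, ← hcm i.succ] at this
          exact lt_of_le_of_ne (Ideal.map_mono ((hcm _ ▸ hcm _ ▸ this).le))
            fun h => this.ne (congrArg (Ideal.comap f) h) }
    have hl' : l'.last.asIdeal = N.map f := congrArg (Ideal.map f) hPlast
    rw [← hl', ← hlen, PrimeSpectrum.height_eq_orderHeight]
    exact Order.length_le_height_last (p := l')
  rw [hn _ (Ideal.comap_isMaximal_of_surjective f hf), hm M inferInstance, ← hn N hN, ← hcard,
    ← hm _ hNmap]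
  refine (Ideal.height_le_height_add_spanFinrank_of_le hIN).trans ?_
  rw [add_comm]
  refine add_le_add ?_ hle
  refine (Nat.cast_le.2 (Submodule.spanFinrank_span_le_ncard_of_finite s.finite_toSet)).trans ?_
  simp

/-- In a domain of finite type over `ℂ`, heights are additive along chains of primes
(the inequality that holds in catenary rings). -/
theorem Ideal.height_le_height_add_height_map [IsDomain R] [Algebra ℂ R]
    [Algebra.FiniteType ℂ R] {Q N : Ideal R} [hQ : Q.IsPrime] [hN : N.IsPrime] (h : Q ≤ N) :
    N.height ≤ Q.height + (N.map (Ideal.Quotient.mk Q)).height := by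
  have : IsNoetherianRing R := Algebra.FiniteType.isNoetherianRing ℂ R
  obtain ⟨M, hM⟩ := Ideal.exists_maximal (R ⧸ N)
  have hfac := Ideal.Quotient.factor_surjective h
  have h1 := Ideal.height_ker_add_le_height_comap (Ideal.Quotient.mk N)
    Ideal.Quotient.mk_surjective M
  have hM' := Ideal.comap_isMaximal_of_surjective _ hfac (K := M)
  have h2 := Ideal.height_comap_le_height_ker_add (Ideal.Quotient.mk Q)
    Ideal.Quotient.mk_surjective (M.comap (Ideal.Quotient.factor h))
  have h3 := Ideal.height_comap_le_height_ker_add (Ideal.Quotient.factor h) hfac M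
  rw [Ideal.comap_comap, Ideal.Quotient.factor_comp_mk] at h2
  rw [Ideal.mk_ker] at h1 h2
  have hker : RingHom.ker (Ideal.Quotient.factor h) = N.map (Ideal.Quotient.mk Q) :=
    Ideal.Quotient.factor_ker h
  rw [hker] at h3
  have h4 := h1.trans (h2.trans (add_le_add_right h3 _))
  rw [← add_assoc] at h4
  exact (ENat.add_le_add_iff_right (M.height_ne_top_of_isPrime)).1 h4

/-- If `m ≤ J + m ^ 2` for a maximal ideal `m` and an ideal `J ≤ m`, then `m` is a minimal
prime of `J`, by Nakayama's lemma. -/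
theorem Ideal.mem_minimalPrimes_of_le_sup_sq [IsNoetherianRing R] {m J : Ideal R}
    [hm : m.IsPrime] (hJ : J ≤ m) (h : m ≤ J ⊔ m ^ 2) : m ∈ J.minimalPrimes := by
  refine ⟨⟨hm, hJ⟩, fun p hp hpm => ?_⟩
  obtain ⟨r, hr, hrm⟩ := Submodule.exists_sub_one_mem_and_smul_le_of_fg_of_le_sup
    (I := m) (IsNoetherian.noetherian m) le_rfl (by simpa [sq] using h)
  have hrp : r ∉ p := fun hrp => hm.ne_top <| m.eq_top_iff_one.2 <| by
    simpa using m.sub_mem (hpm hrp) hr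
  intro x hx
  exact (hp.1.mem_or_mem (hp.2 (hrm (Submodule.smul_mem_pointwise_smul x r m hx)))).resolve_left hrp

/-- Cutting an irreducible variety by `s.card` equations lowers the dimension by at most
`s.card`. -/
theorem Ideal.height_le_height_add_card [IsDomain R] [Algebra ℂ R] [Algebra.FiniteType ℂ R]
    {J P M : Ideal R} [hP : P.IsPrime] [hM : M.IsPrime] (s : Finset R) (hJP : J ≤ P) (hPM : P ≤ M)
    (h : M ∈ (J ⊔ Ideal.span s).minimalPrimes) : M.height ≤ P.height + s.card := by
  classical
  have : IsNoetherianRing R := Algebra.FiniteType.isNoetherianRing ℂ R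
  refine (Ideal.height_le_height_add_height_map hPM).trans (add_le_add_right ?_ _)
  have hmin : M.map (Ideal.Quotient.mk P) ∈
      (Ideal.span (s.image (Ideal.Quotient.mk P) : Set (R ⧸ P))).minimalPrimes := by
    refine ⟨⟨Ideal.isPrime_map_quotientMk_of_isPrime hPM, ?_⟩, fun p hp hpM => ?_⟩
    · rw [Finset.coe_image, ← Ideal.map_span]
      exact Ideal.map_mono (le_sup_right.trans h.1.2)
    · have := hp.1
      rw [Finset.coe_image, ← Ideal.map_span, Ideal.map_le_iff_le_comap] at hp
      rw [Ideal.map_le_iff_le_comap]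
      refine h.2 ⟨Ideal.comap_isPrime _ _, sup_le (hJP.trans fun x hx => ?_) hp.2⟩ ?_
      · simp [Ideal.Quotient.eq_zero_iff_mem.2 hx]
      · refine (Ideal.comap_mono hpM).trans_eq ?_
        rw [Ideal.comap_map_of_surjective _ Ideal.Quotient.mk_surjective,
          ← RingHom.ker_eq_comap_bot, Ideal.mk_ker, sup_eq_left.2 hPM]
  refine (Ideal.height_le_card_of_mem_minimalPrimes_span_finset hmin).trans ?_
  exact_mod_cast Finset.card_image_le

/-- Modulo a non-zero prime `q`, the height of a prime `m` drops, so that `m` can be cut out by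
fewer elements than its height. -/
theorem Ideal.exists_finset_card_lt_height [IsDomain R] [IsNoetherianRing R] {q m : Ideal R}
    [hq : q.IsPrime] [hm : m.IsPrime] (hqm : q ≤ m) (hbot : q ≠ ⊥) :
    ∃ a : Finset R, m ∈ (q ⊔ Ideal.span (a : Set R)).minimalPrimes ∧ 1 + a.card ≤ m.height := by
  classical
  have hmq : (m.map (Ideal.Quotient.mk q)).IsPrime := Ideal.isPrime_map_quotientMk_of_isPrime hqm
  obtain ⟨a', ha', hcard⟩ :=
    (m.map (Ideal.Quotient.mk q)).exists_finset_card_eq_height_of_isNoetherianRing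
  refine ⟨a'.image (Function.surjInv Ideal.Quotient.mk_surjective), ?_, ?_⟩
  · refine Ideal.mem_minimalPrimes_sup hqm ?_
    rw [Ideal.map_span, Finset.coe_image, Set.image_image]
    simpa only [Function.surjInv_eq, Set.image_id'] using ha'
  · have h1 := Ideal.height_ker_add_le_height_comap (Ideal.Quotient.mk q)
      Ideal.Quotient.mk_surjective (m.map (Ideal.Quotient.mk q))
    rw [Ideal.comap_map_of_surjective _ Ideal.Quotient.mk_surjective, ← RingHom.ker_eq_comap_bot,
      Ideal.mk_ker, sup_eq_left.2 hqm, ← hcard] at h1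
    refine le_trans (add_le_add ?_ (Nat.cast_le.2 Finset.card_image_le)) h1
    rw [Order.one_le_iff_ne_zero, Ne, Ideal.height_eq_zero_iff_eq_bot]
    exact hbot

end

namespace CStarVariety

/-! ### Points and the Nullstellensatz -/

section Points

variable {R : Type*} [CommRing R] [Algebra ℂ R]

theorem Points.algebraMap_apply (y : Points R) (c : ℂ) : y (algebraMap ℂ R c) = c :=
  AlgHomClass.commutes y c

theorem Points.smul_apply (y : Points R) (c : ℂ) (f : R) : y (c • f) = c * y f := by
  rw [Algebra.smul_def, map_mul, y.algebraMap_apply]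

theorem Points.sub_algebraMap_mem_ker (y : Points R) (f : R) :
    f - algebraMap ℂ R (y f) ∈ RingHom.ker y := by
  rw [RingHom.mem_ker, map_sub, y.algebraMap_apply, sub_self]

instance Points.ker_isMaximal (y : Points R) : (RingHom.ker y).IsMaximal :=
  RingHom.ker_isMaximal_of_surjective y fun c => ⟨algebraMap ℂ R c, y.algebraMap_apply c⟩

theorem Points.ext_of_ker_le {x y : Points R} (h : RingHom.ker x ≤ RingHom.ker y) : x = y := by
  refine DFunLike.ext _ _ fun f => ?_
  have := (RingHom.mem_ker).1 (h (x.sub_algebraMap_mem_ker f))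
  rw [map_sub, y.algebraMap_apply, sub_eq_zero] at this
  exact this.symm

/-- Hilbert's Nullstellensatz: a prime ideal is cut out by the points of its zero locus. -/
theorem exists_point_of_notMem [Algebra.FiniteType ℂ R] {P : Ideal R} (hP : P.IsPrime) {f : R}
    (hf : f ∉ P) : ∃ x : Points R, P ≤ RingHom.ker x ∧ x f ≠ 0 := by
  have : IsJacobsonRing R := isJacobsonRing_of_finiteType (A := ℂ)
  have hjac : P.jacobson = P := IsJacobsonRing.out' _ hP.isRadical
  rw [← hjac, Ideal.jacobson, Submodule.mem_sInf] at hf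
  push Not at hf
  obtain ⟨M, ⟨hPM, hM⟩, hfM⟩ := hf
  let := Ideal.Quotient.field M
  have : Module.Finite ℂ (R ⧸ M) := finite_of_finite_type_of_isJacobsonRing ℂ (R ⧸ M)
  let e : ℂ ≃ₐ[ℂ] R ⧸ M := AlgEquiv.ofBijective (Algebra.ofId ℂ (R ⧸ M))
    IsAlgClosed.algebraMap_bijective_of_isIntegral
  let x : Points R := (e.symm : (R ⧸ M) →ₐ[ℂ] ℂ).comp (Ideal.Quotient.mkₐ ℂ M)
  have hx (g : R) : x g = 0 ↔ g ∈ M := by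
    change e.symm (Ideal.Quotient.mk M g) = 0 ↔ _
    rw [map_eq_zero_iff _ e.symm.injective, Ideal.Quotient.eq_zero_iff_mem]
  exact ⟨x, fun g hg => (hx g).2 (hPM hg), fun h => hfM ((hx f).1 h)⟩

theorem eq_zero_of_forall_points [Algebra.FiniteType ℂ R] [IsDomain R] {f : R}
    (hf : ∀ x : Points R, x f = 0) : f = 0 := by
  by_contra h
  obtain ⟨x, -, hx⟩ := exists_point_of_notMem (Ideal.isPrime_bot (α := R)) (f := f)
    (by simpa using h)
  exact hx (hf x)

instance [Algebra.FiniteType ℂ R] : TopologicalSpace.NoetherianSpace (Points R) :=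
  have : IsNoetherianRing R := Algebra.FiniteType.isNoetherianRing ℂ R
  Topology.IsInducing.noetherianSpace
    (i := fun y : Points R => (⟨RingHom.ker y, RingHom.ker_isPrime y⟩ : PrimeSpectrum R)) ⟨rfl⟩

end Points

/-! ### Regular points and surjective differentials -/

section Tangent

variable {R S : Type*} [CommRing R] [Algebra ℂ R] [CommRing S] [Algebra ℂ S]

/-- At a regular point, the maximal ideal is generated modulo its square by as many elements as
its height. -/
theorem IsRegularPoint.exists_finset {y : Points R} (hy : IsRegularPoint y) :
    ∃ b : Finset R, (b.card : ℕ∞) ≤ (RingHom.ker y).height ∧ (b : Set R) ⊆ RingHom.ker y ∧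
      RingHom.ker y ≤ Ideal.span (b : Set R) ⊔ (RingHom.ker y) ^ 2 := by
  classical
  have hp : (RingHom.ker y).IsPrime := RingHom.ker_isPrime y
  let A := Localization.AtPrime (RingHom.ker y)
  have hA : IsRegularLocalRing A := hy
  let m := IsLocalRing.maximalIdeal A
  have hdim := IsRegularLocalRing.spanFinrank_maximalIdeal (R := A)
  rw [IsLocalization.AtPrime.ringKrullDim_eq_height (RingHom.ker y) A] at hdim
  replace hdim : (m.spanFinrank : ℕ∞) = (RingHom.ker y).height := by exact_mod_cast hdim
  have hfg : Submodule.FG m := IsNoetherian.noetherian m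
  have hsurj (a : A) : ∃ r : R × (RingHom.ker y).primeCompl,
      a * algebraMap R A r.2 = algebraMap R A r.1 := IsLocalization.surj _ a
  choose r hr using hsurj
  have hunit (a : A) : IsUnit (algebraMap R A (r a).2) := IsLocalization.map_units A (r a).2
  let g := hfg.finite_generators.toFinset
  have hg : Ideal.span (g : Set A) = m := by
    simp only [g, Set.Finite.coe_toFinset]; exact Submodule.span_generators m
  have hmem (a : A) (ha : a ∈ m) : (r a).1 ∈ RingHom.ker y := by
    rw [← IsLocalization.AtPrime.to_map_mem_maximal_iff A (RingHom.ker y), ← hr a]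
    exact m.mul_mem_right _ ha
  refine ⟨g.image fun a => (r a).1, ?_, ?_, ?_⟩
  · rw [← hdim]
    refine (Nat.cast_le.2 Finset.card_image_le).trans (Nat.cast_le.2 ?_)
    rw [← hfg.generators_ncard, Set.ncard_eq_toFinset_card _ hfg.finite_generators]
  · intro x hx
    obtain ⟨a, ha, rfl⟩ := Finset.mem_image.1 (Finset.mem_coe.1 hx)
    exact hmem a (hg ▸ Ideal.subset_span ha)
  · intro x hx
    have hle : m ≤ (Ideal.span ((g.image fun a => (r a).1 : Finset R) : Set R)).map
        (algebraMap R A) := by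
      rw [← hg, Ideal.span_le]
      intro a ha
      rw [SetLike.mem_coe, ← Ideal.mul_unit_mem_iff_mem _ (hunit a), hr]
      exact Ideal.mem_map_of_mem _ (Ideal.subset_span (Finset.mem_coe.2
        (Finset.mem_image_of_mem _ ha)))
    have hx' := hle ((IsLocalization.AtPrime.to_map_mem_maximal_iff A (RingHom.ker y) x).2 hx)
    obtain ⟨s, hs, hsx⟩ := (IsLocalization.algebraMap_mem_map_algebraMap_iff
      (RingHom.ker y).primeCompl A _ _).1 hx'
    have hs0 : y s ≠ 0 := hs
    have : x = (y s)⁻¹ • (s * x) - ((y s)⁻¹ • (s - algebraMap ℂ R (y s))) * x := by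
      rw [smul_mul_assoc, ← smul_sub, sub_mul, sub_sub_cancel, ← Algebra.smul_def, smul_smul,
        inv_mul_cancel₀ hs0, one_smul]
    rw [this]
    refine Ideal.sub_mem _ (Ideal.mem_sup_left ?_) (Ideal.mem_sup_right ?_)
    · exact Submodule.smul_of_tower_mem _ _ hsx
    · rw [sq]
      exact Ideal.mul_mem_mul (Submodule.smul_of_tower_mem _ _ (y.sub_algebraMap_mem_ker s)) hx

/-- Surjectivity of the differential means that the induced map of cotangent spaces is
injective. -/
theorem mem_ker_sq_of_surjective_differential (φ : S →ₐ[ℂ] R) {y : Points R}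
    (hφ : Function.Surjective (differential φ y)) {x : S} (hx : x ∈ RingHom.ker (y.comap φ))
    (hxy : φ x ∈ (RingHom.ker y) ^ 2) : x ∈ (RingHom.ker (y.comap φ)) ^ 2 := by
  set z := y.comap φ
  set m := RingHom.ker z
  by_contra hxm
  obtain ⟨ψ, hψx, hψ⟩ := Submodule.exists_dual_map_eq_bot_of_notMem
    (p := (m ^ 2).restrictScalars ℂ) (x := x)
    (by rwa [Submodule.restrictScalars_mem]) inferInstance
  have hψm {a b : S} (ha : a ∈ m) (hb : b ∈ m) : ψ (a * b) = 0 := by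
    rw [← Submodule.mem_bot ℂ, ← hψ]
    exact Submodule.mem_map_of_mem (by rw [Submodule.restrictScalars_mem, sq]
                                       exact Ideal.mul_mem_mul ha hb)
  -- the point derivation that agrees with `ψ` on `m`
  let δ : S →ₗ[ℂ] ℂ := ψ - (ψ 1) • (AlgHomClass.toAlgHom z).toLinearMap
  have hδ (f : S) : δ f = ψ (f - algebraMap ℂ S (z f)) := by
    have : algebraMap ℂ S (z f) = z f • (1 : S) := Algebra.algebraMap_eq_smul_one _
    rw [map_sub, this, map_smul]
    simp [δ, mul_comm]
  have hδmem : δ ∈ tangentSpace z := by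
    intro f g
    have : f * g - algebraMap ℂ S (z (f * g)) =
        z f • (g - algebraMap ℂ S (z g)) + z g • (f - algebraMap ℂ S (z f)) +
          (f - algebraMap ℂ S (z f)) * (g - algebraMap ℂ S (z g)) := by
      simp only [Algebra.smul_def, map_mul]
      ring
    rw [hδ, hδ, hδ, this, map_add, map_add, map_smul, map_smul,
      hψm (z.sub_algebraMap_mem_ker f) (z.sub_algebraMap_mem_ker g), add_zero, smul_eq_mul,
      smul_eq_mul]
  obtain ⟨δ', hδ'⟩ := hφ ⟨δ, hδmem⟩
  have hval : δ'.1 (φ x) = δ x := DFunLike.congr_fun (congrArg Subtype.val hδ') x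
  have hzero : ∀ r ∈ (RingHom.ker y) ^ 2, δ'.1 r = 0 := by
    intro r hr
    rw [sq] at hr
    refine Submodule.mul_induction_on hr (fun a ha b hb => ?_) fun a b ha hb => ?_
    · rw [δ'.2 a b, (RingHom.mem_ker).1 ha, (RingHom.mem_ker).1 hb, zero_mul, zero_mul, add_zero]
    · rw [map_add, ha, hb, add_zero]
  rw [hzero _ hxy, hδ, (RingHom.mem_ker).1 hx, map_zero, sub_zero] at hval
  exact hψx hval.symm

theorem _root_.Submodule.exists_finset_span_map_eq {X E : Type*} [AddCommGroup X] [Module ℂ X]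
    [AddCommGroup E] [Module ℂ E] (g : X →ₗ[ℂ] E) (W : Submodule ℂ E) [FiniteDimensional ℂ W]
    (X₀ : Submodule ℂ X) (hW : W ≤ X₀.map g) :
    ∃ t : Finset X, t.card ≤ Module.finrank ℂ W ∧ (t : Set X) ⊆ X₀ ∧
      (Submodule.span ℂ (t : Set X)).map g = W := by
  classical
  let b := Module.finBasis ℂ W
  have h (i) : ∃ x ∈ X₀, g x = b i := Submodule.mem_map.1 (hW (b i).2)
  choose x hx hgx using h
  refine ⟨Finset.univ.image x, Finset.card_image_le.trans (by simp), ?_, ?_⟩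
  · intro r hr
    obtain ⟨i, -, rfl⟩ := Finset.mem_image.1 (Finset.mem_coe.1 hr)
    exact hx i
  · rw [Submodule.map_span, Finset.coe_image, Finset.coe_univ, Set.image_univ, ← Set.range_comp]
    have : g ∘ x = W.subtype ∘ b := funext hgx
    rw [this, Set.range_comp, ← Submodule.map_span, b.span_eq, Submodule.map_top,
      Submodule.range_subtype]

/-- The algebraic form of smoothness: if `y` is regular and the differential of `φ` is surjective at
`y`, then the maximal ideal of `y` is generated, modulo its square, by the maximal ideal of the
image point and as many further elements as the heights of the two ideals allow. -/
theorem IsRegularPoint.exists_finset_of_surjective_differential [IsNoetherianRing S]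
    (φ : S →ₐ[ℂ] R) {y : Points R} (hy : IsRegularPoint y)
    (hφ : Function.Surjective (differential φ y)) :
    ∃ s : Finset R, (RingHom.ker (y.comap φ)).height + s.card ≤ (RingHom.ker y).height ∧
      (s : Set R) ⊆ RingHom.ker y ∧
      RingHom.ker y ≤ (RingHom.ker (y.comap φ)).map φ ⊔ Ideal.span s ⊔ (RingHom.ker y) ^ 2 := by
  obtain ⟨b, hbcard, hb, hyb⟩ := hy.exists_finset
  set m := RingHom.ker (y.comap φ)
  set n := RingHom.ker y
  let E := R ⧸ n ^ 2
  let π : R →ₗ[ℂ] E := (Ideal.Quotient.mkₐ ℂ (n ^ 2)).toLinearMap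
  have hπ (r : R) : π r = 0 ↔ r ∈ n ^ 2 := Ideal.Quotient.eq_zero_iff_mem
  let M : Submodule ℂ E := (n.restrictScalars ℂ).map π
  let W : Submodule ℂ E := (m.restrictScalars ℂ).map (π ∘ₗ φ.toLinearMap)
  have hWM : W ≤ M := by
    rintro _ ⟨r, hr, rfl⟩
    exact Submodule.mem_map_of_mem hr
  have hMb : M ≤ Submodule.span ℂ (π '' b) := by
    rintro _ ⟨r, hr, rfl⟩
    obtain ⟨u, hu, v, hv, rfl⟩ := Submodule.mem_sup.1 (hyb hr)
    rw [map_add, (hπ v).2 hv, add_zero]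
    refine Submodule.span_induction (p := fun u _ => π u ∈ Submodule.span ℂ (π '' b)) ?_ ?_ ?_ ?_ hu
    · exact fun u hu => Submodule.subset_span ⟨u, hu, rfl⟩
    · rw [map_zero]; exact zero_mem _
    · exact fun u v _ _ hu hv => by rw [map_add]; exact add_mem hu hv
    · intro a u hu hu'
      have hun : u ∈ n := Ideal.span_le.2 hb hu
      have : a • u = y a • u + (a - algebraMap ℂ R (y a)) * u := by
        rw [Algebra.smul_def (y a), smul_eq_mul]; ring
      have h0 : π ((a - algebraMap ℂ R (y a)) * u) = 0 :=
        (hπ _).2 (sq n ▸ Ideal.mul_mem_mul (y.sub_algebraMap_mem_ker a) hun)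
      rw [this, map_add, h0, add_zero, map_smul]
      exact Submodule.smul_mem _ _ hu'
  have hfin : FiniteDimensional ℂ (Submodule.span ℂ (π '' b)) :=
    FiniteDimensional.span_of_finite ℂ (b.finite_toSet.image π)
  have hMfin : FiniteDimensional ℂ M := Submodule.finiteDimensional_of_le hMb
  have hWfin : FiniteDimensional ℂ W := Submodule.finiteDimensional_of_le hWM
  have hMcard : Module.finrank ℂ M ≤ b.card := by
    classical
    refine (Submodule.finrank_mono hMb).trans ?_
    rw [← Finset.coe_image]
    exact (finrank_span_finset_le_card _).trans Finset.card_image_le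
  -- the image of `m` in the cotangent space at `y` has dimension at least the height of `m`
  obtain ⟨t, htcard, htm, htW⟩ :=
    Submodule.exists_finset_span_map_eq _ W (m.restrictScalars ℂ) le_rfl
  have hmt : m ∈ (Ideal.span (t : Set S)).minimalPrimes := by
    have htm' : Ideal.span (t : Set S) ≤ m := Ideal.span_le.2 htm
    refine Ideal.mem_minimalPrimes_of_le_sup_sq htm' fun x hx => ?_
    have : (π ∘ₗ φ.toLinearMap) x ∈ (Submodule.span ℂ (t : Set S)).map (π ∘ₗ φ.toLinearMap) :=
      htW ▸ Submodule.mem_map_of_mem hx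
    obtain ⟨u, hu, hux⟩ := Submodule.mem_map.1 this
    have hu' : u ∈ Ideal.span (t : Set S) := Submodule.span_le_restrictScalars ℂ S _ hu
    rw [← add_sub_cancel u x]
    refine Ideal.add_mem _ (Ideal.mem_sup_left hu') (Ideal.mem_sup_right ?_)
    refine mem_ker_sq_of_surjective_differential φ hφ (m.sub_mem hx (htm' hu')) ?_
    rw [← hπ, map_sub, map_sub, sub_eq_zero]
    exact hux.symm
  have hmcard := Ideal.height_le_card_of_mem_minimalPrimes_span_finset hmt
  -- the further generators come from a complement of the image of `m`
  obtain ⟨C', hC'⟩ := exists_isCompl W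
  have hsup : W ⊔ C' ⊓ M = M := by
    rw [← sup_inf_assoc_of_le _ hWM, hC'.sup_eq_top, top_inf_eq]
  have hinf : W ⊓ (C' ⊓ M) = ⊥ := by
    rw [← inf_assoc, hC'.inf_eq_bot, bot_inf_eq]
  have hCfin : FiniteDimensional ℂ (C' ⊓ M : Submodule ℂ E) :=
    Submodule.finiteDimensional_of_le inf_le_right
  have hrank := Submodule.finrank_sup_add_finrank_inf_eq W (C' ⊓ M)
  rw [hsup, hinf, finrank_bot, add_zero] at hrank
  obtain ⟨s, hscard, hsn, hsC⟩ := Submodule.exists_finset_span_map_eq π (C' ⊓ M)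
    (n.restrictScalars ℂ) inf_le_right
  refine ⟨s, ?_, hsn, fun x hx => ?_⟩
  · refine le_trans ?_ hbcard
    refine (add_le_add_left hmcard _).trans ?_
    exact_mod_cast (by omega : t.card + s.card ≤ b.card)
  · have hxM : π x ∈ W ⊔ C' ⊓ M := by
      rw [hsup]
      exact Submodule.mem_map_of_mem (p := n.restrictScalars ℂ) hx
    obtain ⟨_, ⟨u, hu, rfl⟩, v, hv, huv⟩ := Submodule.mem_sup.1 hxM
    rw [← hsC] at hv
    obtain ⟨v, hvs, rfl⟩ := Submodule.mem_map.1 hv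
    have hv' : v ∈ Ideal.span (s : Set R) := Submodule.span_le_restrictScalars ℂ R _ hvs
    have : x = φ u + v + (x - (φ u + v)) := by ring
    rw [this]
    refine Ideal.add_mem _ (Ideal.mem_sup_left (Ideal.add_mem _ ?_ ?_)) (Ideal.mem_sup_right ?_)
    · exact Ideal.mem_sup_left (Ideal.mem_map_of_mem φ hu)
    · exact Ideal.mem_sup_right hv'
    · rw [← hπ, map_sub, map_add, ← huv, sub_eq_zero]
      rfl

end Tangent

/-! ### The grading by weights -/

section Grading

theorem zpow_two_injective : Function.Injective fun k : ℤ => (2 : ℂ) ^ k := by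
  intro k l hkl
  have h := congrArg norm hkl
  simp only [norm_zpow, Complex.norm_ofNat] at h
  exact zpow_right_injective₀ (by norm_num : (0 : ℝ) < 2) (by norm_num) h

/-- Distinct characters `t ↦ t ^ k` of `ℂ*` are linearly independent. -/
theorem eq_zero_of_forall_sum_zpow_mul_eq_zero (s : Finset ℤ) (a : ℤ → ℂ)
    (h : ∀ t : ℂˣ, ∑ k ∈ s, (t : ℂ) ^ k * a k = 0) : ∀ k ∈ s, a k = 0 := by
  let χ (k : ℤ) : ℂˣ →* ℂ := (Units.coeHom ℂ).comp (zpowGroupHom k)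
  have hχ (k : ℤ) (t : ℂˣ) : χ k t = (t : ℂ) ^ k := by simp [χ]
  have hinj : Function.Injective χ := by
    intro k l hkl
    have := DFunLike.congr_fun hkl (Units.mk0 2 two_ne_zero)
    rw [hχ, hχ, Units.val_mk0] at this
    exact zpow_two_injective this
  have hli := (linearIndependent_monoidHom ℂˣ ℂ).comp χ hinj
  rw [linearIndependent_iff'] at hli
  refine hli s a ?_
  ext t
  simpa [hχ, mul_comm] using h t

variable (R : Type*) [CommRing R] [Algebra ℂ R] [MulAction ℂˣ (Points R)]

/-- The regular functions of weight `k`: those that transform under the character `t ↦ t ^ k`. -/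
def weightSpace (k : ℤ) : Submodule ℂ R where
  carrier := {f | ∀ (t : ℂˣ) (y : Points R), (t • y) f = (t : ℂ) ^ k * y f}
  add_mem' := by
    intro a b ha hb t y
    simp only [map_add, ha t y, hb t y]
    ring
  zero_mem' := by
    intro t y
    simp
  smul_mem' := by
    intro c a ha t y
    simp only [Points.smul_apply, ha t y]
    ring

variable {R}

theorem mem_invariants_iff {f : R} : f ∈ invariants R ↔ f ∈ weightSpace R 0 := by
  refine forall₂_congr fun t y => ?_
  rw [zpow_zero, one_mul]

instance : SetLike.GradedMonoid (weightSpace R) where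
  one_mem t y := by simp
  mul_mem := by
    intro i j f g hf hg t y
    rw [map_mul, hf t y, hg t y, map_mul, zpow_add₀ t.ne_zero]
    ring

/-- On a fixed point, all weight vectors of non-zero weight vanish. -/
theorem apply_eq_zero_of_mem_fixedPoints {y : Points R}
    (hy : y ∈ MulAction.fixedPoints ℂˣ (Points R)) {k : ℤ} (hk : k ≠ 0) {f : R}
    (hf : f ∈ weightSpace R k) : y f = 0 := by
  have h := hf (Units.mk0 2 two_ne_zero) y
  rw [hy, Units.val_mk0] at h
  by_contra h0
  have h1 : (2 : ℂ) ^ k = 1 := by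
    refine mul_right_cancel₀ h0 ?_
    rw [← h, one_mul]
  exact hk (zpow_two_injective (by simpa using h1))

/-- A regular action splits every regular function into weight vectors. -/
theorem IsRegularAction.exists_finsupp [Algebra.FiniteType ℂ R] [IsDomain R]
    (hact : IsRegularAction R) (f : R) :
    ∃ c : ℤ →₀ R, (∀ k, c k ∈ weightSpace R k) ∧ ∑ k ∈ c.support, c k = f := by
  obtain ⟨q, hq⟩ := hact f
  have hsum : ∃ c : ℤ →₀ R, ∀ (t : ℂˣ) (y : Points R),
      LaurentPolynomial.eval₂ (y : R →+* ℂ) t q = c.sum fun k r => (t : ℂ) ^ k * y r := by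
    clear hq
    induction q using LaurentPolynomial.induction_on' with
    | add p q hp hq =>
      obtain ⟨c, hc⟩ := hp
      obtain ⟨d, hd⟩ := hq
      refine ⟨c + d, fun t y => ?_⟩
      rw [map_add, hc, hd, Finsupp.sum_add_index' (by simp) (by simp [mul_add])]
    | C_mul_T n a =>
      refine ⟨Finsupp.single n a, fun t y => ?_⟩
      rw [LaurentPolynomial.eval₂_C_mul_T, Finsupp.sum_single_index (by simp), mul_comm]
      simp
  obtain ⟨c, hc⟩ := hsum
  have hf (t : ℂˣ) (y : Points R) : (t • y) f = ∑ k ∈ c.support, (t : ℂ) ^ k * y (c k) := by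
    rw [hq, hc, Finsupp.sum]
  refine ⟨c, fun k t y => ?_, ?_⟩
  · by_cases hk : k ∈ c.support
    · rw [← sub_eq_zero]
      refine eq_zero_of_forall_sum_zpow_mul_eq_zero c.support
        (fun k => (t • y) (c k) - (t : ℂ) ^ k * y (c k)) (fun s => ?_) k hk
      simp only [mul_sub]
      rw [Finset.sum_sub_distrib, ← hf, sub_eq_zero, smul_smul, hf]
      refine Finset.sum_congr rfl fun k _ => ?_
      rw [Units.val_mul, mul_zpow, mul_assoc]
    · simp [Finsupp.notMem_support_iff.1 hk]
  · rw [← sub_eq_zero]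
    refine eq_zero_of_forall_points fun y => ?_
    have := hf 1 y
    simp only [one_smul, Units.val_one, one_zpow, one_mul] at this
    rw [map_sub, map_sum, this, sub_self]

/-- The grading of the coordinate ring by the weights of a regular action of `ℂ*`. -/
@[reducible]
noncomputable def IsRegularAction.gradedAlgebra [Algebra.FiniteType ℂ R] [IsDomain R]
    (hact : IsRegularAction R) : GradedAlgebra (weightSpace R) :=
  haveI hint : DirectSum.IsInternal (weightSpace R) := by
    classical
    constructor
    · rw [injective_iff_map_eq_zero]
      intro x hx
      rw [DirectSum.coeAddMonoidHom_eq_dfinsuppSum, DFinsupp.sum] at hx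
      ext k
      by_cases hk : k ∈ x.support
      · refine eq_zero_of_forall_points fun y => ?_
        refine eq_zero_of_forall_sum_zpow_mul_eq_zero x.support (fun k => y (x k))
          (fun t => ?_) k hk
        rw [← map_zero (t • y), ← hx, map_sum]
        exact Finset.sum_congr rfl fun k _ => ((x k).2 t y).symm
      · simpa using hk
    · intro f
      obtain ⟨c, hc, rfl⟩ := hact.exists_finsupp f
      refine ⟨∑ k ∈ c.support, DirectSum.of (fun k => weightSpace R k) k ⟨c k, hc k⟩, ?_⟩
      rw [map_sum]
      exact Finset.sum_congr rfl fun k _ => DirectSum.coeAddMonoidHom_of _ _ _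
  { hint.chooseDecomposition with }

end Grading

/-! ### Weight components and invariants -/

section Weights

variable {R : Type*} [CommRing R] [Algebra ℂ R] [MulAction ℂˣ (Points R)]
  [GradedAlgebra (weightSpace R)]

/-- The component of weight `k` of a regular function. -/
local notation "proj" => GradedRing.proj (weightSpace R)

theorem smul_apply_eq_sum (f : R) : ∃ s : Finset ℤ, (∀ k ∉ s, proj k f = 0) ∧
    ∀ (t : ℂˣ) (y : Points R), (t • y) f = ∑ k ∈ s, (t : ℂ) ^ k * y (proj k f) := by
  classical
  refine ⟨(DirectSum.decompose (weightSpace R) f).support, fun k hk => ?_, fun t y => ?_⟩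
  · simpa [GradedRing.proj_apply] using hk
  · conv_lhs => rw [← DirectSum.sum_support_decompose (weightSpace R) f, map_sum]
    exact Finset.sum_congr rfl fun k _ => (DirectSum.decompose (weightSpace R) f k).2 t y

theorem proj_mem (k : ℤ) (f : R) : proj k f ∈ weightSpace R k :=
  (DirectSum.decompose (weightSpace R) f k).2

theorem proj_zero_mul_of_mem {a : R} (ha : a ∈ weightSpace R 0) (b : R) :
    proj 0 (a * b) = a * proj 0 b :=
  DirectSum.coe_decompose_mul_of_left_mem_zero _ ha

theorem exists_proj_ne_zero {f : R} {y : Points R} (hf : y f ≠ 0) : ∃ k, y (proj k f) ≠ 0 := by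
  obtain ⟨s, -, hs⟩ := smul_apply_eq_sum f
  by_contra! h
  refine hf ?_
  rw [← one_smul ℂˣ y, hs]
  exact Finset.sum_eq_zero fun k _ => by rw [h, mul_zero]

/-- The functions vanishing on a stable set form a homogeneous ideal. -/
theorem proj_apply_eq_zero_of_isStable {D : Set (Points R)} (hD : IsStable D) {f : R}
    (hf : ∀ x ∈ D, x f = 0) (k : ℤ) : ∀ x ∈ D, x (proj k f) = 0 := by
  intro x hx
  obtain ⟨s, hs0, hs⟩ := smul_apply_eq_sum f
  by_cases hk : k ∈ s
  · exact eq_zero_of_forall_sum_zpow_mul_eq_zero s (fun k => x (proj k f))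
      (fun t => by rw [← hs, hf _ (hD t x hx)]) k hk
  · rw [hs0 k hk, map_zero]

/-- At a point that is not fixed, some weight vector of non-zero weight does not vanish. -/
theorem exists_weight_ne_zero {y : Points R} (hy : y ∉ MulAction.fixedPoints ℂˣ (Points R)) :
    ∃ k ≠ 0, ∃ u ∈ weightSpace R k, y u ≠ 0 := by
  by_contra! h
  refine hy fun t => DFunLike.ext _ _ fun f => ?_
  obtain ⟨s, -, hs⟩ := smul_apply_eq_sum f
  rw [hs]
  conv_rhs => rw [← one_smul ℂˣ y, hs]
  refine Finset.sum_congr rfl fun k _ => ?_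
  by_cases hk : k = 0
  · simp [hk]
  · rw [h k hk _ (proj_mem k f), mul_zero, mul_zero]

/-- Minimal primes of homogeneous ideals are homogeneous. -/
theorem _root_.Ideal.IsHomogeneous.of_mem_minimalPrimes {I P : Ideal R}
    (hI : I.IsHomogeneous (weightSpace R)) (hP : P ∈ I.minimalPrimes) :
    P.IsHomogeneous (weightSpace R) := by
  have hle := Ideal.toIdeal_homogeneousCore_le (weightSpace R) P
  rw [Ideal.IsHomogeneous.iff_eq]
  refine le_antisymm hle (hP.2 ⟨hP.1.1.homogeneousCore, ?_⟩ hle)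
  rw [← hI.toIdeal_homogeneousCore_eq_self]
  exact Ideal.homogeneousCore_mono _ hP.1.2

/-- The Reynolds operator, i.e. the projection to weight zero, maps the extension of an ideal of
invariants back to that ideal. -/
theorem exists_mem_eq_proj_zero_of_mem_map {m : Ideal (invariants R)} {r : R}
    (hr : r ∈ m.map (invariants R).val) : ∃ a ∈ m, (a : R) = proj 0 r := by
  have hr' : ∀ c : R, ∃ a ∈ m, (a : R) = proj 0 (c * r) := by
    refine Submodule.span_induction (p := fun r _ => ∀ c : R, ∃ a ∈ m, (a : R) = proj 0 (c * r))
      ?_ ?_ ?_ ?_ hr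
    · rintro _ ⟨a, ha, rfl⟩ c
      refine ⟨a * ⟨proj 0 c, mem_invariants_iff.2 (proj_mem 0 c)⟩, m.mul_mem_right _ ha, ?_⟩
      rw [mul_comm c]
      exact (proj_zero_mul_of_mem (mem_invariants_iff.1 a.2) c).symm
    · exact fun c => ⟨0, m.zero_mem, by rw [mul_zero, map_zero]; rfl⟩
    · intro x y _ _ hx hy c
      obtain ⟨a, ha, ha'⟩ := hx c
      obtain ⟨b, hb, hb'⟩ := hy c
      exact ⟨a + b, m.add_mem ha hb, by rw [mul_add, map_add, ← ha', ← hb']; rfl⟩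
    · intro d x _ hx c
      obtain ⟨a, ha, ha'⟩ := hx (c * d)
      exact ⟨a, ha, by rw [ha', smul_eq_mul, mul_assoc]⟩
  simpa using hr' 1

theorem isNoetherianRing_invariants [IsNoetherianRing R] : IsNoetherianRing (invariants R) := by
  have hle {I J : Ideal (invariants R)}
      (h : I.map (invariants R).val ≤ J.map (invariants R).val) : I ≤ J := by
    intro a ha
    obtain ⟨b, hb, hba⟩ := exists_mem_eq_proj_zero_of_mem_map (h (Ideal.mem_map_of_mem _ ha))
    have : (b : R) = a :=
      hba.trans (DirectSum.decompose_of_mem_same _ (mem_invariants_iff.1 a.2))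
    rwa [← Subtype.ext this]
  have hmono : StrictMono (Ideal.map (invariants R).val) := fun I J h =>
    lt_of_le_not_ge (Ideal.map_mono h.le) fun h' => h.not_ge (hle h')
  exact isNoetherianRing_iff.2 (isNoetherian_iff'.2 hmono.wellFoundedGT)

/-- If the invariants in a homogeneous ideal `Q` lie in a proper ideal `m` of invariants, then the
zero set of `Q` meets the preimage of that of `m`. -/
theorem sup_map_ne_top {Q : Ideal R} (hQ : Q.IsHomogeneous (weightSpace R))
    {m : Ideal (invariants R)} (hm : m ≠ ⊤) (hQm : Q.comap (invariants R).val ≤ m) :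
    Q ⊔ m.map (invariants R).val ≠ ⊤ := by
  intro htop
  obtain ⟨q, hq, r, hr, hqr⟩ := Submodule.mem_sup.1 ((Ideal.eq_top_iff_one _).1 htop)
  obtain ⟨a, ha, har⟩ := exists_mem_eq_proj_zero_of_mem_map hr
  have hq0 : proj 0 q ∈ Q := hQ 0 hq
  have h1 : proj 0 (1 : R) = 1 := DirectSum.decompose_of_mem_same _ SetLike.GradedOne.one_mem
  have hsum : proj 0 q + a = 1 := by rw [har, ← map_add, hqr, h1]
  have h1a : (1 - a : invariants R) ∈ m := by
    refine hQm (Ideal.mem_comap.2 ?_)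
    have : (invariants R).val (1 - a) = proj 0 q := by
      rw [map_sub, map_one, ← hsum]
      exact add_sub_cancel_right _ _
    rwa [this]
  exact hm ((Ideal.eq_top_iff_one _).2 (by simpa using m.add_mem h1a ha))

end Weights

/-! ### Zariski closed sets and prime ideals -/

section Zariski

variable {R : Type*} [CommRing R] [Algebra ℂ R]

/-- The ideal of the regular functions vanishing on a set of points. -/
def vanishingIdeal (Z : Set (Points R)) : Ideal R where
  carrier := {f | ∀ x ∈ Z, x f = 0}
  add_mem' := fun ha hb x hx => by rw [map_add, ha x hx, hb x hx, add_zero]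
  zero_mem' := fun x _ => map_zero x
  smul_mem' := fun c f hf x hx => by rw [smul_eq_mul, map_mul, hf x hx, mul_zero]

theorem vanishingIdeal_le_ker {Z : Set (Points R)} {x : Points R} (hx : x ∈ Z) :
    vanishingIdeal Z ≤ RingHom.ker x := fun _ hf => hf x hx

theorem vanishingIdeal_isRadical (Z : Set (Points R)) : (vanishingIdeal Z).IsRadical := by
  rintro f ⟨n, hn⟩ x hx
  have := hn x hx
  rw [map_pow] at this
  exact eq_zero_of_pow_eq_zero this

theorem mem_of_isClosed {Z : Set (Points R)} (hZ : IsClosed Z) {x : Points R}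
    (hx : vanishingIdeal Z ≤ RingHom.ker x) : x ∈ Z := by
  obtain ⟨S, rfl⟩ := (isClosed_iff_zeroLocus Z).1 hZ
  exact fun f hf => hx fun y hy => hy f hf

theorem isClosed_setOf_le_ker (I : Ideal R) : IsClosed {x : Points R | I ≤ RingHom.ker x} :=
  (isClosed_iff_zeroLocus _).2 ⟨I, rfl⟩

theorem isClosed_setOf_apply_eq_zero (f : R) : IsClosed {x : Points R | x f = 0} :=
  (isClosed_iff_zeroLocus _).2 ⟨{f}, by simp⟩

theorem vanishingIdeal_isPrime {Z : Set (Points R)} (hZ : IsIrreducible Z) :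
    (vanishingIdeal Z).IsPrime := by
  obtain ⟨x, hx⟩ := hZ.1
  refine Ideal.isPrime_iff.2 ⟨fun h => ?_, fun {f g} hfg => ?_⟩
  · have := (Ideal.eq_top_iff_one _).1 h x hx
    rw [map_one] at this
    exact one_ne_zero this
  · refine isPreirreducible_iff_isClosed_union_isClosed.1 hZ.2 _ _
      (isClosed_setOf_apply_eq_zero f) (isClosed_setOf_apply_eq_zero g) fun x hx => ?_
    have := hfg x hx
    rw [map_mul] at this
    exact mul_eq_zero.1 this

variable [Algebra.FiniteType ℂ R]

theorem vanishingIdeal_setOf_le_ker {P : Ideal R} (hP : P.IsPrime) :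
    vanishingIdeal {x : Points R | P ≤ RingHom.ker x} = P := by
  refine le_antisymm (fun f hf => ?_) fun f hf x hx => hx hf
  by_contra h
  obtain ⟨x, hx, hxf⟩ := exists_point_of_notMem hP h
  exact hxf (hf x hx)

/-- The irreducible closed set defined by a prime ideal. -/
def irreducibleZeroLocus (P : PrimeSpectrum R) :
    TopologicalSpace.IrreducibleCloseds (Points R) where
  carrier := {x | P.asIdeal ≤ RingHom.ker x}
  isIrreducible' := by
    have hP := P.isPrime
    constructor
    · obtain ⟨x, hx, -⟩ := exists_point_of_notMem hP ((Ideal.ne_top_iff_one _).1 hP.ne_top)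
      exact ⟨x, hx⟩
    · rw [isPreirreducible_iff_isClosed_union_isClosed]
      intro z₁ z₂ hz₁ hz₂ h
      by_contra! hnot
      obtain ⟨⟨x₁, hx₁, hxz₁⟩, x₂, hx₂, hxz₂⟩ := hnot.imp Set.not_subset.1 Set.not_subset.1
      obtain ⟨f, hf, hfx⟩ := SetLike.not_le_iff_exists.1 fun hle => hxz₁ (mem_of_isClosed hz₁ hle)
      obtain ⟨g, hg, hgx⟩ := SetLike.not_le_iff_exists.1 fun hle => hxz₂ (mem_of_isClosed hz₂ hle)
      have hfg : f * g ∉ P.asIdeal := fun hfg =>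
        (hP.mem_or_mem hfg).elim (fun h => hfx (hx₁ h)) fun h => hgx (hx₂ h)
      obtain ⟨x, hx, hxfg⟩ := exists_point_of_notMem hP hfg
      rw [map_mul] at hxfg
      rcases h hx with h | h
      · exact hxfg (by rw [hf x h, zero_mul])
      · exact hxfg (by rw [hg x h, mul_zero])
  isClosed' := isClosed_setOf_le_ker _

theorem irreducibleZeroLocus_strictAnti :
    StrictAnti (irreducibleZeroLocus : PrimeSpectrum R → _) := by
  intro P Q hPQ
  have hle : P.asIdeal ≤ Q.asIdeal := hPQ.le
  refine lt_of_le_not_ge (fun x (hx : Q.asIdeal ≤ RingHom.ker x) => hle.trans hx)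
    fun h => hPQ.not_ge ?_
  rw [← PrimeSpectrum.asIdeal_le_asIdeal, ← vanishingIdeal_setOf_le_ker P.isPrime]
  exact fun f hf x hx => h hx hf

/-- The minimal primes of the ideal of a closed set of pure codimension one have height at most
one. -/
theorem IsPureCodimOne.height_le_one {D : Set (Points R)} (hD : IsPureCodimOne D)
    (hclosed : IsClosed D) {Q : Ideal R} (hQ : Q ∈ (vanishingIdeal D).minimalPrimes) :
    Q.height ≤ 1 := by
  have hQp : Q.IsPrime := hQ.1.1
  let Z := irreducibleZeroLocus ⟨Q, hQp⟩
  have hZD : (Z : Set (Points R)) ⊆ D := fun x (hx : Q ≤ _) =>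
    mem_of_isClosed hclosed (hQ.1.2.trans hx)
  have hcomp : (Z : Set (Points R)) ∈ componentsOf D := by
    refine ⟨Subtype.val ⁻¹' (Z : Set (Points R)), ⟨⟨?_, ?_⟩, ?_⟩, ?_⟩
    · obtain ⟨x, hx⟩ := Z.isIrreducible.1
      exact ⟨⟨x, hZD hx⟩, hx⟩
    · rintro _ _ ⟨U, hU, rfl⟩ ⟨W, hW, rfl⟩ ⟨x, hx, hxU⟩ ⟨y, hy, hyW⟩
      obtain ⟨t, ht, htUW⟩ := Z.isIrreducible.2 U W hU hW ⟨x, hx, hxU⟩ ⟨y, hy, hyW⟩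
      exact ⟨⟨t, hZD ht⟩, ht, htUW⟩
    · intro T hT hZT x hx
      have hT' : IsIrreducible (Subtype.val '' T : Set (Points R)) :=
        hT.image _ continuous_subtype_val.continuousOn
      have hle : vanishingIdeal (Subtype.val '' T : Set (Points R)) ≤ Q := by
        rw [← vanishingIdeal_setOf_le_ker hQp]
        exact fun f hf x hx => hf x ⟨⟨x, hZD hx⟩, hZT hx, rfl⟩
      have hge := hQ.2 ⟨vanishingIdeal_isPrime hT', ?_⟩ hle
      · exact hge.trans (vanishingIdeal_le_ker ⟨x, hx, rfl⟩)
      · rintro f hf _ ⟨x, -, rfl⟩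
        exact hf x x.2
    · exact (Subtype.image_preimage_coe _ _).trans (Set.inter_eq_right.2 hZD)
  rw [PrimeSpectrum.height_eq_orderHeight ⟨Q, hQp⟩, ← hD Z hcomp]
  exact Order.height_le_height_apply_of_strictMono
    (fun P => OrderDual.toDual (irreducibleZeroLocus P))
    (fun P Q h => irreducibleZeroLocus_strictAnti h) ⟨Q, hQp⟩

end Zariski

/-! ### Divisors and fibres of the quotient map -/

section Fibres

variable {R : Type*} [CommRing R] [Algebra ℂ R] [MulAction ℂˣ (Points R)]

theorem quotientMap_eq_of_map_ker_le {x v : Points R}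
    (h : (RingHom.ker (quotientMap v)).map (invariants R).val ≤ RingHom.ker x) :
    quotientMap x = quotientMap v := by
  have hle : RingHom.ker (quotientMap v) ≤ RingHom.ker (quotientMap x) := by
    intro a ha
    have : x ((invariants R).val a) = 0 := h (Ideal.mem_map_of_mem (invariants R).val ha)
    exact this
  exact (Points.ext_of_ker_le hle).symm

/-- The vanishing ideal of the fibre of the quotient map through `v`. -/
def fibreIdeal (v : Points R) : Ideal R := vanishingIdeal (quotientMap ⁻¹' {quotientMap v})

theorem map_ker_le_fibreIdeal (v : Points R) :
    (RingHom.ker (quotientMap v)).map (invariants R).val ≤ fibreIdeal v := by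
  rw [Ideal.map_le_iff_le_comap]
  intro a ha x hx
  have : quotientMap x a = 0 := by rw [show quotientMap x = quotientMap v from hx]; exact ha
  exact this

theorem fibreIdeal_le_ker (v : Points R) : fibreIdeal v ≤ RingHom.ker v :=
  vanishingIdeal_le_ker rfl

theorem IsRegularOpenSet.fibreIdeal_isPrime {V : Set (Points R)} (hV : IsRegularOpenSet V)
    {v : Points R} (hv : v ∈ V) : (fibreIdeal v).IsPrime :=
  vanishingIdeal_isPrime (hV.irreducible_fibre _ ⟨v, hv, rfl⟩)

theorem fibreIdeal_le [Algebra.FiniteType ℂ R] {v : Points R} {N : Ideal R} (hN : N.IsPrime)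
    (h : (RingHom.ker (quotientMap v)).map (invariants R).val ≤ N) : fibreIdeal v ≤ N := by
  intro f hf
  by_contra hfN
  obtain ⟨x, hNx, hxf⟩ := exists_point_of_notMem hN hfN
  exact hxf (hf x (quotientMap_eq_of_map_ker_le (h.trans hNx)))

variable [Algebra.FiniteType ℂ R] [IsDomain R] [GradedAlgebra (weightSpace R)]

/-- By regularity, the codimension of a fibre is at least the local dimension of the quotient. -/
theorem IsRegularOpenSet.height_le_height_fibreIdeal {V : Set (Points R)}
    (hV : IsRegularOpenSet V) {v : Points R} (hv : v ∈ V) :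
    (RingHom.ker (quotientMap v)).height ≤ (fibreIdeal v).height := by
  have : IsNoetherianRing R := Algebra.FiniteType.isNoetherianRing ℂ R
  have : IsNoetherianRing (invariants R) := isNoetherianRing_invariants
  have hP := hV.fibreIdeal_isPrime hv
  obtain ⟨hreg, hsurj⟩ := (hV.regularFibre _ ⟨v, hv, rfl⟩).2 v hv rfl
  obtain ⟨s, hs, hsv, hle⟩ := hreg.exists_finset_of_surjective_differential _ hsurj
  have hle' := sup_le ((map_ker_le_fibreIdeal v).trans (fibreIdeal_le_ker v)) (Ideal.span_le.2 hsv)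
  have := hs.trans (Ideal.height_le_height_add_card s (map_ker_le_fibreIdeal v)
    (fibreIdeal_le_ker v) (Ideal.mem_minimalPrimes_of_le_sup_sq hle' hle))
  exact (ENat.add_le_add_iff_right (ENat.natCast_ne_top _)).1 this

/-- A homogeneous prime divisor which does not dominate the quotient, but whose image contains the
image of a point `v` of `V`, contains the fibre through `v`. Indeed, its image has positive
codimension, so by Krull's height theorem it meets that fibre in a set whose codimension in `Y` is
at most that of the fibre, and the fibre is irreducible. -/
theorem IsRegularOpenSet.le_ker_of_height_le_one {V : Set (Points R)} (hV : IsRegularOpenSet V)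
    {v : Points R} (hv : v ∈ V) {Q : Ideal R} (hQ : Q.IsPrime)
    (hQhom : Q.IsHomogeneous (weightSpace R)) (hQheight : Q.height ≤ 1)
    (hQbot : Q.comap (invariants R).val ≠ ⊥)
    (hQv : Q.comap (invariants R).val ≤ RingHom.ker (quotientMap v)) : Q ≤ RingHom.ker v := by
  classical
  have : IsNoetherianRing R := Algebra.FiniteType.isNoetherianRing ℂ R
  have : IsNoetherianRing (invariants R) := isNoetherianRing_invariants
  have hP := hV.fibreIdeal_isPrime hv
  have hq : (Q.comap (invariants R).val).IsPrime := Ideal.comap_isPrime _ _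
  obtain ⟨a, ha, hcard⟩ := Ideal.exists_finset_card_lt_height hQv hQbot
  obtain ⟨M, hM, hMle⟩ := Ideal.exists_le_maximal _
    (sup_map_ne_top hQhom (Points.ker_isMaximal (quotientMap v)).ne_top hQv)
  rw [sup_le_iff] at hMle
  have hMm : RingHom.ker (quotientMap v) = M.comap (invariants R).val :=
    (Points.ker_isMaximal (quotientMap v)).eq_of_le (Ideal.comap_ne_top _ hM.ne_top)
      (Ideal.map_le_iff_le_comap.1 hMle.2)
  have ha₁ : Ideal.span ((a.image (invariants R).val : Finset R) : Set R) =
      (Ideal.span (a : Set (invariants R))).map (invariants R).val := by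
    rw [Finset.coe_image, Ideal.map_span]
  have ha₁M : Q ⊔ Ideal.span ((a.image (invariants R).val : Finset R) : Set R) ≤ M := by
    refine sup_le hMle.1 ?_
    rw [ha₁]
    exact (Ideal.map_mono (le_sup_right.trans ha.1.2)).trans hMle.2
  -- a component of the intersection of the divisor with the zero set of `a`; it lies in the fibre
  obtain ⟨N, hN, hNM⟩ := Ideal.exists_minimalPrimes_le ha₁M
  have hNp : N.IsPrime := hN.1.1
  have hQN : Q ≤ N := le_sup_left.trans hN.1.2
  have hmN : RingHom.ker (quotientMap v) ≤ N.comap (invariants R).val := by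
    refine ha.2 ⟨Ideal.comap_isPrime _ _, sup_le (Ideal.comap_mono hQN) ?_⟩
      ((Ideal.comap_mono hNM).trans_eq hMm.symm)
    rw [← Ideal.map_le_iff_le_comap, ← ha₁]
    exact le_sup_right.trans hN.1.2
  have hPN := fibreIdeal_le hNp (Ideal.map_le_iff_le_comap.2 hmN)
  have hNheight : N.height ≤ (fibreIdeal v).height := by
    refine (Ideal.height_le_height_add_card _ le_rfl hQN hN).trans
      (le_trans ?_ (hV.height_le_height_fibreIdeal hv))
    exact le_trans (add_le_add hQheight (Nat.cast_le.2 Finset.card_image_le)) hcard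
  have heq : fibreIdeal v = N := Ideal.eq_of_le_of_height_le _ hPN hNheight
  exact (hQN.trans_eq heq.symm).trans (fibreIdeal_le_ker v)

/-- If weights of both signs occur, then a function `u` of weight `l` that does not vanish at a
point `v` of `V` is invertible near the fibre through `v`. Otherwise the closure of the image of
some component of its zero set contains the image of `v`; this image is not dense, because some product
of powers of `u` and of a function of a weight of the opposite sign is invariant; so the component
contains `v`. -/
theorem exists_mem_weightSpace_neg {V : Set (Points R)} (hV : IsRegularOpenSet V) {v : Points R}
    (hv : v ∈ V) {l : ℤ} {u : R} (hu : u ∈ weightSpace R l) (huv : v u ≠ 0) {j : ℤ} {g : R}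
    (hg : g ∈ weightSpace R j) (hg0 : g ≠ 0) (hlj : l * j < 0) :
    ∃ w ∈ weightSpace R (-l), v w ≠ 0 := by
  have : IsNoetherianRing R := Algebra.FiniteType.isNoetherianRing ℂ R
  let S : Submonoid R := (RingHom.ker (quotientMap v)).primeCompl.map (invariants R).val
  have hnot : ¬ Disjoint (Ideal.span {u} : Set R) S := by
    intro hdisj
    obtain ⟨p, hp, hup, hpS⟩ := Ideal.exists_le_prime_disjoint _ S hdisj
    obtain ⟨Q, hQ, hQp⟩ := Ideal.exists_minimalPrimes_le hup
    have huQ : u ∈ Q := hQ.1.2 (Ideal.mem_span_singleton_self u)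
    have hhom : Q.IsHomogeneous (weightSpace R) :=
      (Ideal.homogeneous_span (weightSpace R) {u} fun x hx =>
        ⟨l, (Set.mem_singleton_iff.1 hx).symm ▸ hu⟩).of_mem_minimalPrimes hQ
    have hj0 : j ≠ 0 := by rintro rfl; simp at hlj
    have hu0 : u ≠ 0 := by rintro rfl; simp at huv
    -- an invariant in `Q`
    have hh : u ^ j.natAbs * g ^ l.natAbs ∈ invariants R := by
      rw [mem_invariants_iff]
      have := SetLike.mul_mem_graded (SetLike.pow_mem_graded j.natAbs hu)
        (SetLike.pow_mem_graded l.natAbs hg)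
      have hdeg : j.natAbs • l + l.natAbs • j = 0 := by
        rcases mul_neg_iff.1 hlj with ⟨h1, h2⟩ | ⟨h1, h2⟩
        · simp only [nsmul_eq_mul, Int.natCast_natAbs, abs_of_neg h2, abs_of_pos h1]; ring
        · simp only [nsmul_eq_mul, Int.natCast_natAbs, abs_of_neg h1, abs_of_pos h2]; ring
      rwa [hdeg] at this
    refine huv (hV.le_ker_of_height_le_one hv hQ.1.1 hhom
      (Ideal.height_le_one_of_isPrincipal_of_mem_minimalPrimes _ Q hQ) (fun hbot => ?_) ?_ huQ)
    · have : (⟨_, hh⟩ : invariants R) ∈ Q.comap (invariants R).val :=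
        Q.mul_mem_right _ (Ideal.pow_mem_of_mem _ huQ _ (Int.natAbs_pos.2 hj0))
      rw [hbot, Ideal.mem_bot] at this
      exact mul_ne_zero (pow_ne_zero _ hu0) (pow_ne_zero _ hg0) (congrArg Subtype.val this)
    · intro s hs
      by_contra hsv
      exact Set.disjoint_left.1 hpS (hQp hs) ⟨s, hsv, rfl⟩
  obtain ⟨x, hx, hxS⟩ := Set.not_disjoint_iff.1 hnot
  obtain ⟨s, hs, rfl⟩ := hxS
  obtain ⟨r, hr⟩ := Ideal.mem_span_singleton'.1 hx
  -- `r * u` is the invariant `s`, so the part of `r` of weight `-l` will do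
  refine ⟨GradedRing.proj (weightSpace R) (-l) r, proj_mem _ _, fun h0 => hs ?_⟩
  have h1 := DirectSum.coe_decompose_mul_add_of_left_mem (weightSpace R) (j := -l) (b := r) hu
  have hs0 : (invariants R).val s ∈ weightSpace R 0 := mem_invariants_iff.1 s.2
  rw [mul_comm u, hr, add_neg_cancel, DirectSum.decompose_of_mem_same _ hs0] at h1
  have h2 : v ((invariants R).val s) = v u * v (GradedRing.proj (weightSpace R) (-l) r) := by
    rw [← map_mul]; exact congrArg v h1
  rw [h0, mul_zero] at h2
  exact h2

end Fibres

/-! ### Weights of functions vanishing on a divisor -/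

section Divisor

variable {R : Type*} [CommRing R] [Algebra ℂ R] [MulAction ℂˣ (Points R)]

/-- The functions of weight `k` vanishing on `D`. -/
def vanishingWeightSpace (D : Set (Points R)) (k : ℤ) : Submodule ℂ R :=
  (vanishingIdeal D).restrictScalars ℂ ⊓ weightSpace R k

theorem mul_mem_vanishingWeightSpace {D : Set (Points R)} {k l : ℤ} {f u : R}
    (hf : f ∈ vanishingWeightSpace D k) (hu : u ∈ weightSpace R l) :
    f * u ∈ vanishingWeightSpace D (k + l) :=
  ⟨Ideal.mul_mem_right u _ hf.1, SetLike.mul_mem_graded hf.2 hu⟩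

theorem pow_mem_vanishingWeightSpace {D : Set (Points R)} {k : ℤ} {f : R} {n : ℕ} (hn : 0 < n)
    (hf : f ∈ vanishingWeightSpace D k) : f ^ n ∈ vanishingWeightSpace D (n * k) :=
  ⟨Ideal.pow_mem_of_mem _ hf.1 n hn, by simpa using SetLike.pow_mem_graded n hf.2⟩

variable [GradedAlgebra (weightSpace R)]

theorem vanishingIdeal_isHomogeneous {D : Set (Points R)} (hD : IsStable D) :
    (vanishingIdeal D).IsHomogeneous (weightSpace R) :=
  fun k _ hf => proj_apply_eq_zero_of_isStable hD hf k

theorem exists_mem_vanishingWeightSpace {D : Set (Points R)} (hD : IsStable D)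
    (hclosed : IsClosed D) {y : Points R} (hy : y ∉ D) :
    ∃ k, ∃ f ∈ vanishingWeightSpace D k, y f ≠ 0 := by
  obtain ⟨f, hf, hfy⟩ := SetLike.not_le_iff_exists.1 fun hle => hy (mem_of_isClosed hclosed hle)
  obtain ⟨k, hk⟩ := exists_proj_ne_zero (y := y) hfy
  exact ⟨k, _, ⟨vanishingIdeal_isHomogeneous hD k hf, proj_mem k f⟩, hk⟩

theorem exists_mem_vanishingWeightSpace_ne_zero {D : Set (Points R)} (hD : IsStable D)
    (hclosed : IsClosed D) {y : Points R} (hy : y ∉ D)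
    (hfix : y ∉ MulAction.fixedPoints ℂˣ (Points R)) :
    ∃ k ≠ 0, ∃ f ∈ vanishingWeightSpace D k, y f ≠ 0 := by
  obtain ⟨j, f, hf, hfy⟩ := exists_mem_vanishingWeightSpace hD hclosed hy
  obtain ⟨l, hl, u, hu, huy⟩ := exists_weight_ne_zero hfix
  by_cases hj : j = 0
  · refine ⟨l, hl, f * u, ?_, by rw [map_mul]; exact mul_ne_zero hfy huy⟩
    have := mul_mem_vanishingWeightSpace hf hu
    rwa [hj, zero_add] at this
  · exact ⟨j, hj, f, hf, hfy⟩

variable [Algebra.FiniteType ℂ R] [IsDomain R]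

/-- If there are functions of weight `k ≠ 0`, then every point of `V` has a function vanishing on
`D`, but not at that point, whose weight is a positive multiple of `k`. -/
theorem IsRegularOpenSet.exists_mem_vanishingWeightSpace_mul {V D : Set (Points R)}
    (hV : IsRegularOpenSet V) (hDV : D ⊆ Vᶜ) (hD : IsStable D) (hclosed : IsClosed D)
    {k : ℤ} (hk : k ≠ 0) {g : R} (hg : g ∈ weightSpace R k) (hg0 : g ≠ 0)
    {v : Points R} (hv : v ∈ V) :
    ∃ n : ℕ, 0 < n ∧ ∃ f ∈ vanishingWeightSpace D (n * k), v f ≠ 0 := by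
  obtain ⟨j, f, hf, hfv⟩ := exists_mem_vanishingWeightSpace hD hclosed fun h => hDV h hv
  obtain ⟨l, hlk, u, hu, huv⟩ : ∃ l, 0 < l * k ∧ ∃ u ∈ weightSpace R l, v u ≠ 0 := by
    obtain ⟨l, hl, u, hu, huv⟩ := exists_weight_ne_zero (hV.subset_compl_fixedPoints hv)
    rcases (mul_ne_zero hl hk).lt_or_gt with h | h
    · exact ⟨-l, by linarith, exists_mem_weightSpace_neg hV hv hu huv hg hg0 h⟩
    · exact ⟨l, h, u, hu, huv⟩
  -- multiplying `f` by a high power of `u` gives its weight `e` the sign of `k`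
  have hmem := mul_mem_vanishingWeightSpace hf (SetLike.pow_mem_graded (j.natAbs + 1) hu)
  set e : ℤ := j + (j.natAbs + 1) • l
  have he : 0 < e * k := by
    have hj : -|j| * |k| ≤ j * k := by rw [neg_mul, ← abs_mul]; exact neg_abs_le _
    have hkk : |k| ≤ l * k := by
      rw [← abs_of_pos hlk, abs_mul]
      exact le_mul_of_one_le_left (abs_nonneg k) (Int.one_le_abs fun h => by simp [h] at hlk)
    have habs : 0 < |k| := abs_pos.2 hk
    have : e * k = j * k + (|j| + 1) * (l * k) := by
      simp only [e, nsmul_eq_mul]; push_cast [Int.natCast_natAbs]; ring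
    rw [this]
    nlinarith [abs_nonneg j, mul_le_mul_of_nonneg_left hkk (by positivity : 0 ≤ |j| + 1)]
  have he0 : e ≠ 0 := by rintro h; simp [h] at he
  refine ⟨e.natAbs, Int.natAbs_pos.2 he0, (f * u ^ (j.natAbs + 1)) ^ k.natAbs, ?_, ?_⟩
  · have := pow_mem_vanishingWeightSpace (Int.natAbs_pos.2 hk) hmem
    have hdeg : (k.natAbs : ℤ) * e = e.natAbs * k := by
      rcases pos_and_pos_or_neg_and_neg_of_mul_pos he with ⟨h1, h2⟩ | ⟨h1, h2⟩
      · simp only [Int.natCast_natAbs, abs_of_pos h1, abs_of_pos h2]; ring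
      · simp only [Int.natCast_natAbs, abs_of_neg h1, abs_of_neg h2]; ring
    rwa [hdeg] at this
  · rw [map_pow, map_mul, map_pow]
    exact pow_ne_zero _ (mul_ne_zero hfv (pow_ne_zero _ huv))

/-- If some fixed point lies outside `D`, then no component of `D` dominates the quotient, and the
images of `D` and `V` in the quotient are disjoint. -/
theorem IsRegularOpenSet.exists_mem_vanishingWeightSpace_zero {V D : Set (Points R)}
    (hV : IsRegularOpenSet V) (hDV : D ⊆ Vᶜ) (hD : IsStable D) (hclosed : IsClosed D)
    (hcodim : IsPureCodimOne D) {y : Points R} (hy : y ∉ D)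
    (hfix : y ∈ MulAction.fixedPoints ℂˣ (Points R)) {v : Points R} (hv : v ∈ V) :
    ∃ f ∈ vanishingWeightSpace D 0, v f ≠ 0 := by
  have : IsNoetherianRing R := Algebra.FiniteType.isNoetherianRing ℂ R
  by_contra! h
  have hle : (vanishingIdeal D).comap (invariants R).val ≤ RingHom.ker (quotientMap v) :=
    fun a ha => h a ⟨ha, mem_invariants_iff.1 a.2⟩
  have hfin := Ideal.finite_minimalPrimes_of_isNoetherianRing R (vanishingIdeal D)
  have hinf : hfin.toFinset.inf (fun Q => Q.comap (invariants R).val) ≤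
      RingHom.ker (quotientMap v) := by
    refine le_trans (fun a ha => ?_) hle
    rw [Submodule.mem_finsetInf] at ha
    rw [Ideal.mem_comap, ← (vanishingIdeal_isRadical D).radical, ← Ideal.sInf_minimalPrimes,
      Submodule.mem_sInf]
    exact fun Q hQ => ha Q (hfin.mem_toFinset.2 hQ)
  rw [(Points.ker_isMaximal (quotientMap v)).isPrime.inf_le'] at hinf
  obtain ⟨Q, hQ, hQv⟩ := hinf
  rw [Set.Finite.mem_toFinset] at hQ
  obtain ⟨k, f, hf, hfy⟩ := exists_mem_vanishingWeightSpace hD hclosed hy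
  have hk : k = 0 := by
    by_contra hk
    exact hfy (apply_eq_zero_of_mem_fixedPoints hfix hk hf.2)
  have hbot : Q.comap (invariants R).val ≠ ⊥ := by
    intro hbot
    have hfQ : (⟨f, mem_invariants_iff.2 (hk ▸ hf.2)⟩ : invariants R) ∈
        Q.comap (invariants R).val := hQ.1.2 hf.1
    rw [hbot, Ideal.mem_bot] at hfQ
    have : f = 0 := congrArg Subtype.val hfQ
    exact hfy (by rw [this, map_zero])
  have := hV.le_ker_of_height_le_one hv hQ.1.1
    ((vanishingIdeal_isHomogeneous hD).of_mem_minimalPrimes hQ)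
    (hcodim.height_le_one hclosed hQ) hbot hQv
  exact hDV (mem_of_isClosed hclosed (hQ.1.2.trans this)) hv

/-- A single weight works for finitely many points of `V` and the point `y`. -/
theorem IsRegularOpenSet.exists_mem_vanishingWeightSpace_forall {V D : Set (Points R)}
    (hV : IsRegularOpenSet V) (hDV : D ⊆ Vᶜ) (hD : IsStable D) (hclosed : IsClosed D)
    (hcodim : IsPureCodimOne D) {y : Points R} (hy : y ∉ D) {ι : Type*} [Finite ι]
    (v : ι → Points R) (hv : ∀ i, v i ∈ V) :
    ∃ k, ∃ f ∈ vanishingWeightSpace D k, y f ≠ 0 ∧ ∀ i, v i f ≠ 0 := by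
  have := Fintype.ofFinite ι
  obtain ⟨k, ⟨f₀, hf₀, hfy₀⟩, hk⟩ : ∃ k, (∃ f ∈ vanishingWeightSpace D k, y f ≠ 0) ∧
      ∀ i, ∃ n : ℕ, 0 < n ∧ ∃ f ∈ vanishingWeightSpace D (n * k), v i f ≠ 0 := by
    by_cases hfix : y ∈ MulAction.fixedPoints ℂˣ (Points R)
    · obtain ⟨k, f, hf, hfy⟩ := exists_mem_vanishingWeightSpace hD hclosed hy
      have hk : k = 0 := by
        by_contra hk
        exact hfy (apply_eq_zero_of_mem_fixedPoints hfix hk hf.2)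
      subst hk
      refine ⟨0, ⟨f, hf, hfy⟩, fun i => ⟨1, one_pos, ?_⟩⟩
      rw [mul_zero]
      exact hV.exists_mem_vanishingWeightSpace_zero hDV hD hclosed hcodim hy hfix (hv i)
    · obtain ⟨k, hk, f, hf, hfy⟩ := exists_mem_vanishingWeightSpace_ne_zero hD hclosed hy hfix
      refine ⟨k, ⟨f, hf, hfy⟩, fun i =>
        hV.exists_mem_vanishingWeightSpace_mul hDV hD hclosed hk hf.2 ?_ (hv i)⟩
      rintro rfl
      exact hfy (map_zero y)
  choose n hn f hf hfv using hk
  let N := ∏ i, n i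
  have hN : 0 < N := Finset.prod_pos fun i _ => hn i
  obtain ⟨f, hf, hfne⟩ := Module.Dual.exists_forall_mem_ne_zero_of_forall_exists
    (ι := Option ι) (vanishingWeightSpace D (N * k))
    (fun i => (AlgHomClass.toAlgHom (i.elim y v) : R →ₐ[ℂ] ℂ).toLinearMap) (by
      rintro (_ | i)
      · refine ⟨f₀ ^ N, pow_mem_vanishingWeightSpace hN hf₀, ?_⟩
        change y (f₀ ^ N) ≠ 0
        rw [map_pow]
        exact pow_ne_zero _ hfy₀
      · obtain ⟨c, hc⟩ : n i ∣ N := Finset.dvd_prod_of_mem n (Finset.mem_univ i)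
        have hc0 : 0 < c := Nat.pos_of_ne_zero fun h => by simp [h] at hc; omega
        refine ⟨f i ^ c, ?_, ?_⟩
        · have := pow_mem_vanishingWeightSpace hc0 (hf i)
          rwa [← mul_assoc, ← Nat.cast_mul, mul_comm c, ← hc] at this
        · change v i (f i ^ c) ≠ 0
          rw [map_pow]
          exact pow_ne_zero _ (hfv i))
  exact ⟨N * k, f, hf, hfne none, fun i => hfne (some i)⟩

end Divisor

end CStarVariety

theorem lemma3p2 {R : Type*} [CommRing R] [Algebra ℂ R] [Algebra.FiniteType ℂ R] [IsDomain R]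
    [IsIntegrallyClosed R] [MulAction ℂˣ (CStarVariety.Points R)]
    (hact : CStarVariety.IsRegularAction R)
    (V : Set (CStarVariety.Points R)) (hV : CStarVariety.IsRegularOpenSet V)
    (D : Set (CStarVariety.Points R)) (hDV : D ⊆ Vᶜ) (hDclosed : IsClosed D)
    (hDstable : CStarVariety.IsStable D) (hDcodim : CStarVariety.IsPureCodimOne D)
    (A : Set (CStarVariety.Points R)) (hA : CStarVariety.IsClosedIn A V)
    (hAstable : CStarVariety.IsStable A)
    (y : CStarVariety.Points R) (hy : y ∉ D) :
    ∃ f : R, CStarVariety.IsHomogeneous f ∧ (∀ x ∈ D, x f = 0) ∧ y f ≠ 0 ∧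
      ∀ Z ∈ CStarVariety.componentsOf A, ¬ Z ⊆ {x | x ∈ V ∧ x f = 0} := by
  let := hact.gradedAlgebra
  have hfin : Finite (CStarVariety.componentsOf A) :=
    (TopologicalSpace.NoetherianSpace.finite_irreducibleComponents.image _).to_subtype
  have hpt (Z : CStarVariety.componentsOf A) : ∃ v : CStarVariety.Points R, v ∈ Z.1 ∧ v ∈ V := by
    obtain ⟨_, T, hT, rfl⟩ := Z
    obtain ⟨x, hx⟩ := hT.1.1
    exact ⟨x, ⟨x, hx, rfl⟩, hA.1 x.2⟩
  choose v hvZ hvV using hpt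
  obtain ⟨k, f, hf, hfy, hfv⟩ := hV.exists_mem_vanishingWeightSpace_forall hDV hDstable hDclosed
    hDcodim hy v hvV
  exact ⟨f, ⟨k, hf.2⟩, hf.1, hfy, fun Z hZ hsub => hfv ⟨Z, hZ⟩ (hsub (hvZ ⟨Z, hZ⟩)).2⟩
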